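/- Let $M\ge 1$ be an integer and let $\Sigma=\{0,\dots,M\}^{\mathbb N}$ carry the product topology, the shift $\sigma$ and the lexicographic order $\preccurlyeq$; write $\overline{(x_i)}=(M-x_i)$. For $q\in(1,M+1]$ let $\alpha(q)\in\Sigma$ be the quasi-greedy expansion of $1$ in base $q$, that is, the lexicographically largest sequence $(a_i)$ with infinitely many non-zero terms and $\sum_{i\ge1}a_iq^{-i}=1$, and put $$\mathbf V_q=\{x\in\Sigma:\ \overline{\alpha(q)}\preccurlyeq\sigma^n(x)\preccurlyeq\alpha(q)\ \text{for all } n\ge0\}.$$ Let $\mathbf V=\{a\in\Sigma:\ \overline a\preccurlyeq\sigma^n(a)\preccurlyeq a\ \text{for all } n\ge0\}$. A sequence $a\in\mathbf V$ is irreducible if $a_1\cdots a_j(\overline{a_1\cdots a_j}^{\,+})^\infty\prec a$ for every $j\ge1$ such that $a_j>0$ and $(a_1\cdots a_j^-)^\infty\in\mathbf V$, where ${}^+$ and ${}^-$ raise and lower the last symbol of a word by one. Let $\mathcal I$ be the set of $q\in(1,M+1]$ such that $\alpha(q)$ belongs to $\mathbf V$ and is irreducible. Let $q_G$ be the generalised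 golden ratio: $q_G=k+1$ if $M=2k$, and $q_G=\bigl(k+1+\sqrt{k^2+6k+5}\bigr)/2$ if $M=2k+1$. Let $q_T$ be the base with $\alpha(q_T)=(k+1)k^\infty$ if $M=2k$, and $\alpha(q_T)=(k+1)((k+1)k)^\infty$ if $M=2k+1$. A subshift is a non-empty, closed, forward $\sigma$-invariant set $X\subset\Sigma$; $\mathcal L(X)$ is the set of finite words (including the empty word) occurring in elements of $X$. It is transitive if for all $u,v\in\mathcal L(X)$ there is $w\in\mathcal L(X)$ with $uwv\in\mathcal L(X)$; it is mixing if for all $u,v\in\mathcal L(X)$ there is $N$ such that for every $n\ge N$ there is $w\in\mathcal L(X)$ of length $n$ with $uwv\in\mathcal L(X)$; it is of finite type if it is the set of all sequences in $\Sigma$ that avoid some finite set of words. (i) If $q\in\mathcal I$, and $q\ne q_G$ in case $M$ is odd, then $(\mathbf V_q,\sigma)$ is a mixing subshift. (ii) If $q\in\mathcal I$ and $\alpha(q)$ is periodic, then $(\mathbf V_q,\sigma)$ is a subshift of finite type, and it is mixing unless $M$ is odd and $q=q_G$. (iii) Let $q\in[q_G,M+1]$ be such that $(\mathbf V_q,\sigma)$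 is a transitive subshift; in case $M$ is odd, assume also that $q\ne q_T$ and $\mathbf V_q\ne\mathbf V_{q_G}$. Then $(\mathbf V_q,\sigma)$ is mixing. -/

import Mathlib

namespace SymShift

/-- One-sided infinite sequences over the alphabet `{0, …, M}`; it carries the product topology of
the discrete alphabet. The terms of a sequence are indexed from `0`, so that `x i` is the symbol
`x_{i+1}` of the usual notation. -/
abbrev Seqs (M : ℕ) : Type := ℕ → Fin (M + 1)

variable {M : ℕ}

/-- The lexicographic order `x ≼ y` on sequences. -/
def LexLE (x y : Seqs M) : Prop := toLex x ≤ toLex y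

/-- The strict lexicographic order `x ≺ y` on sequences. -/
def LexLT (x y : Seqs M) : Prop := toLex x < toLex y

/-- The shift map `σ`. -/
def shift (x : Seqs M) : Seqs M := fun n => x (n + 1)

/-- The reflection of a sequence, `x_i ↦ M - x_i`. -/
def reflect (x : Seqs M) : Seqs M := fun n => (x n).rev

/-- A sequence is periodic if `σ^m x = x` for some `m ≥ 1`. -/
def IsPeriodic (x : Seqs M) : Prop := ∃ m : ℕ, 1 ≤ m ∧ shift^[m] x = x

/-! ### Subshifts -/

/-- The word `w` occurs in the sequence `x`. -/
def IsFactor (w : List (Fin (M + 1))) (x : Seqs M) : Prop :=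
  ∃ k : ℕ, ∀ i : Fin w.length, w.get i = x (k + i)

/-- The admissible words of length `n` of `X`. -/
def admissibleWords (X : Set (Seqs M)) (n : ℕ) : Set (List (Fin (M + 1))) :=
  {w | w.length = n ∧ ∃ x ∈ X, IsFactor w x}

/-- The language of `X`. -/
def language (X : Set (Seqs M)) : Set (List (Fin (M + 1))) :=
  ⋃ n : ℕ, admissibleWords X n

/-- A subshift: a non-empty, closed, forward shift-invariant set of sequences. -/
def IsSubshift (X : Set (Seqs M)) : Prop :=
  X.Nonempty ∧ IsClosed X ∧ Set.MapsTo shift X X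

/-- A topologically transitive subshift. -/
def IsTransitiveSubshift (X : Set (Seqs M)) : Prop :=
  IsSubshift X ∧
    ∀ u ∈ language X, ∀ v ∈ language X, ∃ w ∈ language X, u ++ w ++ v ∈ language X

/-- A topologically mixing subshift. -/
def IsMixingSubshift (X : Set (Seqs M)) : Prop :=
  IsSubshift X ∧
    ∀ u ∈ language X, ∀ v ∈ language X, ∃ N : ℕ, ∀ n : ℕ, N ≤ n →
      ∃ w ∈ admissibleWords X n, u ++ w ++ v ∈ language X

/-- A subshift of finite type: a subshift given by finitely many forbidden words. -/
def IsSubshiftOfFiniteType (X : Set (Seqs M)) : Prop :=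
  IsSubshift X ∧ ∃ F : Set (List (Fin (M + 1))), F.Finite ∧
    X = {x | ∀ w ∈ F, ¬ IsFactor w x}

/-! ### The quasi-greedy expansion of `1` -/

/-- `a` is an expansion of `x` in base `q`. -/
def IsExpansion (q x : ℝ) (a : Seqs M) : Prop :=
  HasSum (fun i : ℕ => ((a i : ℕ) : ℝ) / q ^ (i + 1)) x

/-- `a` is the lexicographically largest among the expansions of `1` in base `q` that have
infinitely many non-zero digits. -/
def IsQuasiGreedyOne (q : ℝ) (a : Seqs M) : Prop :=
  (IsExpansion q 1 a ∧ {i : ℕ | a i ≠ 0}.Infinite) ∧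
    ∀ b : Seqs M, IsExpansion q 1 b → {i : ℕ | b i ≠ 0}.Infinite → LexLE b a

/-- The quasi-greedy expansion `α(q)` of `1` in base `q`. It is only meaningful for `M ≥ 1` and
`1 < q ≤ M + 1`, where `isQuasiGreedyOne_alpha` and `isQuasiGreedyOne_unique` below say that it is
the one and only quasi-greedy expansion of `1`. -/
noncomputable def alpha (M : ℕ) (q : ℝ) : Seqs M :=
  Classical.epsilon fun a : Seqs M => IsQuasiGreedyOne q a

theorem isQuasiGreedyOne_unique {q : ℝ} {a b : Seqs M} (ha : IsQuasiGreedyOne q a)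
    (hb : IsQuasiGreedyOne q b) : a = b := by
  have h1 := ha.2 b hb.1.1 hb.1.2
  have h2 := hb.2 a ha.1.1 ha.1.2
  exact toLex.injective (le_antisymm h2 h1)

/-- The digit chosen by the quasi-greedy algorithm at remainder `r`. -/
noncomputable def qgDigit (M : ℕ) (q r : ℝ) : ℕ := min M (⌈q * r⌉₊ - 1)

/-- The remainders of the quasi-greedy algorithm started at `1`. -/
noncomputable def qgRem (M : ℕ) (q : ℝ) : ℕ → ℝ
  | 0 => 1
  | n + 1 => q * qgRem M q n - qgDigit M q (qgRem M q n)

theorem qgRem_bounds {q : ℝ} (hq : 1 < q) (hq' : q ≤ M + 1) (n : ℕ) :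
    0 < qgRem M q n ∧ qgRem M q n ≤ M / (q - 1) := by
  have hq1 : 0 < q - 1 := by linarith
  have h1 : (1 : ℝ) ≤ M / (q - 1) := by
    rw [le_div_iff₀ hq1]; linarith
  induction n with
  | zero => exact ⟨by simp [qgRem], by simpa [qgRem] using h1⟩
  | succ n ih =>
    obtain ⟨h0, hle⟩ := ih
    set r := qgRem M q n with hr
    have hqr : 0 < q * r := by positivity
    have hc : 1 ≤ ⌈q * r⌉₊ := Nat.one_le_ceil_iff.2 hqr
    have hc1 : q * r ≤ ⌈q * r⌉₊ := Nat.le_ceil _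
    have hc2 : (⌈q * r⌉₊ : ℝ) < q * r + 1 := Nat.ceil_lt_add_one hqr.le
    have hrec : qgRem M q (n + 1) = q * r - qgDigit M q r := by simp [qgRem, hr]
    rw [hrec]
    unfold qgDigit
    rcases le_total M (⌈q * r⌉₊ - 1) with h | h
    · rw [min_eq_left h]
      have h2 : (M : ℝ) + 1 ≤ ⌈q * r⌉₊ := by
        have : M + 1 ≤ ⌈q * r⌉₊ := by omega
        exact_mod_cast this
      refine ⟨by linarith, ?_⟩
      rw [le_div_iff₀ hq1] at hle ⊢
      nlinarith
    · rw [min_eq_right h]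
      have h2 : ((⌈q * r⌉₊ - 1 : ℕ) : ℝ) = ⌈q * r⌉₊ - 1 := by
        rw [Nat.cast_sub hc]; simp
      rw [h2]
      exact ⟨by linarith, by linarith⟩

theorem qgRem_sum {q : ℝ} (hq : 1 < q) (n : ℕ) :
    ∑ i ∈ Finset.range n, (qgDigit M q (qgRem M q i) : ℝ) / q ^ (i + 1)
      = 1 - qgRem M q n / q ^ n := by
  have hq0 : q ≠ 0 := by linarith
  induction n with
  | zero => simp [qgRem]
  | succ n ih =>
    rw [Finset.sum_range_succ, ih]
    simp only [qgRem]
    field_simp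
    ring

theorem exists_isQuasiGreedyOne {q : ℝ} (hq : 1 < q) (hq' : q ≤ M + 1) :
    ∃ a : Seqs M, IsQuasiGreedyOne q a := by
  have hq0 : 0 < q := by linarith
  have hq1 : 0 < q - 1 := by linarith
  let a : Seqs M := fun n =>
    ⟨qgDigit M q (qgRem M q n), Nat.lt_succ_of_le (min_le_left _ _)⟩
  have hav : ∀ n, ((a n : ℕ) : ℝ) = (qgDigit M q (qgRem M q n) : ℝ) := fun n => rfl
  have hsum : IsExpansion q 1 a := by
    unfold IsExpansion
    rw [hasSum_iff_tendsto_nat_of_nonneg (fun i => by positivity)]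
    simp only [hav, qgRem_sum hq]
    have hlim : Filter.Tendsto (fun n : ℕ => qgRem M q n / q ^ n) Filter.atTop (nhds 0) := by
      have hb : Filter.Tendsto (fun n : ℕ => (M / (q - 1)) * (q⁻¹) ^ n) Filter.atTop
          (nhds ((M / (q - 1)) * 0)) :=
        (tendsto_pow_atTop_nhds_zero_of_lt_one (by positivity)
          (inv_lt_one_of_one_lt₀ hq)).const_mul _
      rw [mul_zero] at hb
      refine squeeze_zero (fun n => ?_) (fun n => ?_) hb
      · exact div_nonneg (qgRem_bounds hq hq' n).1.le (by positivity)
      · rw [inv_pow, ← div_eq_mul_inv]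
        exact div_le_div_of_nonneg_right (qgRem_bounds hq hq' n).2 (by positivity)
    simpa using hlim.const_sub 1
  have hinf : {i : ℕ | a i ≠ 0}.Infinite := by
    rw [Set.infinite_iff_exists_gt]
    by_contra! hcon
    obtain ⟨n, hn⟩ := hcon
    have hz : ∀ i, n < i → qgDigit M q (qgRem M q i) = 0 := by
      intro i hi
      by_contra h
      have : a i ≠ 0 := fun h' => h (congrArg Fin.val h')
      exact absurd (hn i this) (by omega)
    have hgrow : ∀ k, qgRem M q (n + 1 + k) = q ^ k * qgRem M q (n + 1) := by
      intro k
      induction k with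
      | zero => simp
      | succ k ih =>
        have : qgRem M q (n + 1 + (k + 1))
            = q * qgRem M q (n + 1 + k) - qgDigit M q (qgRem M q (n + 1 + k)) := rfl
        rw [this, hz _ (by omega), ih, pow_succ]
        push_cast
        ring
    have hpos := (qgRem_bounds hq hq' (n + 1)).1
    obtain ⟨k, hk⟩ := pow_unbounded_of_one_lt (M / (q - 1) / qgRem M q (n + 1)) hq
    rw [div_lt_iff₀ hpos, ← hgrow k] at hk
    exact absurd (qgRem_bounds hq hq' (n + 1 + k)).2 (not_le.2 hk)
  refine ⟨a, ⟨hsum, hinf⟩, fun b hb hbinf => ?_⟩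
  by_contra hlt
  unfold LexLE at hlt
  rw [not_le] at hlt
  obtain ⟨i, hi, hilt⟩ := hlt
  have hi' : ∀ j < i, a j = b j := hi
  have hilt' : (a i : ℕ) < (b i : ℕ) := hilt
  obtain ⟨j, hj, hij⟩ := Set.infinite_iff_exists_gt.1 hbinf i
  have hfin : ∑ k ∈ insert j (Finset.range (i + 1)), ((b k : ℕ) : ℝ) / q ^ (k + 1) ≤ 1 :=
    sum_le_hasSum _ (fun k _ => by positivity) hb
  have hjn : j ∉ Finset.range (i + 1) := by simp; omega
  rw [Finset.sum_insert hjn, Finset.sum_range_succ] at hfin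
  have hS : ∑ k ∈ Finset.range i, ((b k : ℕ) : ℝ) / q ^ (k + 1) = 1 - qgRem M q i / q ^ i := by
    rw [← qgRem_sum hq]
    refine Finset.sum_congr rfl fun k hk => ?_
    rw [← hi' k (Finset.mem_range.1 hk)]
  have hbj : 0 < ((b j : ℕ) : ℝ) / q ^ (j + 1) := by
    have : 0 < (b j : ℕ) := Nat.pos_of_ne_zero fun h => hj (Fin.ext h)
    have : (0 : ℝ) < ((b j : ℕ) : ℝ) := by exact_mod_cast this
    positivity
  rw [hS] at hfin
  have hlt2 : ((b i : ℕ) : ℝ) / q ^ (i + 1) < qgRem M q i / q ^ i := by linarith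
  have hlt3 : ((b i : ℕ) : ℝ) < q * qgRem M q i := by
    rw [div_lt_div_iff₀ (by positivity) (by positivity), pow_succ] at hlt2
    have hp : 0 < q ^ i := by positivity
    by_contra hge
    rw [not_lt] at hge
    nlinarith [mul_le_mul_of_nonneg_right hge hp.le]
  have hlt4 : (b i : ℕ) < ⌈q * qgRem M q i⌉₊ := Nat.lt_ceil.2 hlt3
  have hai : (a i : ℕ) = min M (⌈q * qgRem M q i⌉₊ - 1) := rfl
  have hbM : (b i : ℕ) < M + 1 := (b i).2
  rw [hai] at hilt'
  rcases min_lt_iff.1 hilt' with h | h <;> omega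

theorem isQuasiGreedyOne_alpha {q : ℝ} (hq : 1 < q) (hq' : q ≤ M + 1) :
    IsQuasiGreedyOne q (alpha M q) :=
  Classical.epsilon_spec (exists_isQuasiGreedyOne hq hq')

/-! ### Symmetric `q`-shifts -/

/-- The set **V** of sequences `a` with `reflect a ≼ σ^n a ≼ a` for every `n ≥ 0`. -/
def seqV (M : ℕ) : Set (Seqs M) :=
  {a | ∀ n : ℕ, LexLE (reflect a) (shift^[n] a) ∧ LexLE (shift^[n] a) a}

/-- The set 𝒱 of bases `q ∈ (1, M + 1]` with `α(q)` in **V**. -/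
def baseV (M : ℕ) : Set ℝ := {q | 1 < q ∧ q ≤ M + 1 ∧ alpha M q ∈ seqV M}

/-- The symmetric `q`-shift **V**_q. -/
def symShift (M : ℕ) (q : ℝ) : Set (Seqs M) :=
  {x | ∀ n : ℕ, LexLE (reflect (alpha M q)) (shift^[n] x) ∧ LexLE (shift^[n] x) (alpha M q)}

/-! ### Irreducible sequences -/

/-- The prefix of length `n` of a sequence. -/
def prefixWord (x : Seqs M) (n : ℕ) : Fin n → Fin (M + 1) := fun i => x i

/-- The reflection of a word. -/
def reflectWord {n : ℕ} (w : Fin n → Fin (M + 1)) : Fin n → Fin (M + 1) := fun i => (w i).rev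

/-- `w⁻`: the last symbol of `w` is decreased by one (used only if that symbol is positive). -/
def wordMinus {n : ℕ} (w : Fin (n + 1) → Fin (M + 1)) : Fin (n + 1) → Fin (M + 1) :=
  Function.update w (Fin.last n) ⟨(w (Fin.last n) : ℕ) - 1, by omega⟩

/-- `w⁺`: the last symbol of `w` is increased by one (used only if that symbol is less than
`M`). -/
def wordPlus {n : ℕ} (w : Fin (n + 1) → Fin (M + 1)) : Fin (n + 1) → Fin (M + 1) :=
  Function.update w (Fin.last n) ⟨min ((w (Fin.last n) : ℕ) + 1) M, by omega⟩

/-- `w^∞`, the infinite concatenation of the non-empty word `w` with itself. -/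
def wordRepeat {n : ℕ} (w : Fin (n + 1) → Fin (M + 1)) : Seqs M :=
  fun i => w ⟨i % (n + 1), Nat.mod_lt _ n.succ_pos⟩

/-- The concatenation of the word `w` and the sequence `x`. -/
def wordAppend {n : ℕ} (w : Fin n → Fin (M + 1)) (x : Seqs M) : Seqs M :=
  fun i => if h : i < n then w ⟨i, h⟩ else x (i - n)

/-- A sequence `a` in **V** is irreducible if `a_1…a_j (reflect(a_1…a_j)⁺)^∞ ≺ a` for each `j ≥ 1`
such that `(a_1…a_j⁻)^∞` (which presupposes `a_j > 0`) lies in **V**. Here `j` is written as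
`n + 1`, so that `a_j` is `a n`. -/
def IsIrreducibleSeq (a : Seqs M) : Prop :=
  a ∈ seqV M ∧ ∀ n : ℕ, 0 < a n →
    wordRepeat (wordMinus (prefixWord a (n + 1))) ∈ seqV M →
      LexLT (wordAppend (prefixWord a (n + 1))
        (wordRepeat (wordPlus (reflectWord (prefixWord a (n + 1)))))) a

/-- The set `I` of the bases `q ∈ 𝒱` whose `α(q)` is irreducible. -/
def baseI (M : ℕ) : Set ℝ := {q | q ∈ baseV M ∧ IsIrreducibleSeq (alpha M q)}

/-! ### Two special bases -/

/-- The generalised golden ratio `q_G(M)`: it is `k + 1` if `M = 2k`, and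
`(k + 1 + √(k² + 6k + 5)) / 2` if `M = 2k + 1`. -/
noncomputable def qG (M : ℕ) : ℝ :=
  if Even M then ((M / 2 : ℕ) : ℝ) + 1
  else (((M / 2 : ℕ) : ℝ) + 1
    + Real.sqrt (((M / 2 : ℕ) : ℝ) ^ 2 + 6 * ((M / 2 : ℕ) : ℝ) + 5)) / 2

/-- The quasi-greedy expansion of the transitive base: `(k + 1) k^∞` if `M = 2k`, and
`(k + 1) ((k + 1) k)^∞` if `M = 2k + 1`. -/
def transitiveSeq (M : ℕ) : Seqs M := fun n =>
  Fin.ofNat (M + 1)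
    (if n = 0 then M / 2 + 1 else if Even M then M / 2 else if Odd n then M / 2 + 1 else M / 2)

/-- `q` is the transitive base `q_T(M)`. -/
def IsTransitiveBase (M : ℕ) (q : ℝ) : Prop :=
  1 < q ∧ q ≤ M + 1 ∧ alpha M q = transitiveSeq M

end SymShift

namespace SymShift

variable {M : ℕ}

/-! ### Sequences, shifts and splicing -/

/-! Write k for `M / 2`, T for `transitiveSeq M`, x̄ for the reflection of x, and a_1 for `a 0`.
Every shift in question is a `box a`, so apart from identifying `q_G` everything is about words and
their order. Mixing comes from a gluing criterion, `isMixingSubshift_of_connecting`; for irreducible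
a the freely attachable set Q is `openBox a`.

The core is `exists_continuation`. Let w be a prefix of a none of whose suffixes is a reflected
prefix of a. Once its last symbol is lowered, no upper bound at a shift starting inside w⁻ can fail,
whatever follows, and a lower bound is in danger only along a suffix of w⁻ that equals some ū with u
a prefix of a. The longest such u again has no reflected suffix and, outside a one-letter case
treated by hand, is shorter than w, so u⁻ can be continued by induction. Irreducibility at u says
exactly that ū(u⁻)^∞ lies strictly above ā, so enough copies of u⁻ placed after w⁻ settle the
endangered comparisons. Suitable w exist in every large size (`exists_noReflectedSuffix_of_ne`)
because no shift of an irreducible a equals ā; hence every admissible word can be completed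
(`exists_extension`).

Gaps of all large lengths: if 2a_1 > M + 1, the symbol a_1 - 1 can be inserted freely. If 2a_1 = M +
1, irreducibility at the prefix of length two gives T ≺ a, unless a = ((k+1)k)^∞, the expansion for
`q_G`; then blocks (k+1)k and prefixes of T supply even and odd lengths. If 2a_1 = M, the box is the
single point k^∞.

For finite type, a comparison with a periodic a is decided inside one period. For transitive shifts,
α(q) need not lie in V, so it is replaced by the largest element b of the box and compared with T.
If T ≺ b, transitivity forces irreducibility (`isIrreducibleSeq_of_transitive`). If b ≺ T,
transitivity fails, except for the one-point box and the box of `q_G`. The case b = T is excluded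
for odd M and settled directly for even M. -/

theorem shift_iterate_apply (n : ℕ) (x : Seqs M) (i : ℕ) : shift^[n] x i = x (n + i) := by
  induction n generalizing x with
  | zero => simp
  | succ n ih =>
    rw [Function.iterate_succ_apply, ih]
    exact congrArg x (by omega)

@[simp] theorem reflect_apply (x : Seqs M) (i : ℕ) : reflect x i = (x i).rev := rfl

@[simp] theorem reflect_reflect (x : Seqs M) : reflect (reflect x) = x := by
  funext i; simp

theorem reflect_shift_iterate (n : ℕ) (x : Seqs M) :
    reflect (shift^[n] x) = shift^[n] (reflect x) := by
  funext i; simp [shift_iterate_apply]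

theorem shift_iterate_add (m n : ℕ) (x : Seqs M) :
    shift^[m] (shift^[n] x) = shift^[n + m] x := by
  funext i; simp [shift_iterate_apply, add_assoc]

/-- The sequence that consists of the first `m` symbols of `x`, followed by `y`. -/
def splice (m : ℕ) (x y : Seqs M) : Seqs M := fun i => if i < m then x i else y (i - m)

theorem splice_of_lt {m i : ℕ} (h : i < m) (x y : Seqs M) : splice m x y i = x i := if_pos h

theorem splice_add (m i : ℕ) (x y : Seqs M) : splice m x y (m + i) = y i := by
  simp [splice]

theorem splice_of_le {m i : ℕ} (h : m ≤ i) (x y : Seqs M) : splice m x y i = y (i - m) :=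
  if_neg (by omega)

@[simp] theorem splice_zero (x y : Seqs M) : splice 0 x y = y := by
  funext i; simp [splice]

theorem shift_iterate_splice_add (m n : ℕ) (x y : Seqs M) :
    shift^[m + n] (splice m x y) = shift^[n] y := by
  funext i; rw [shift_iterate_apply, shift_iterate_apply, add_assoc, splice_add]

theorem shift_iterate_splice_self (m : ℕ) (x y : Seqs M) : shift^[m] (splice m x y) = y := by
  simpa using shift_iterate_splice_add m 0 x y

theorem shift_iterate_splice {n m : ℕ} (h : n ≤ m) (x y : Seqs M) :
    shift^[n] (splice m x y) = splice (m - n) (shift^[n] x) y := by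
  funext i
  rw [shift_iterate_apply]
  unfold splice
  by_cases hi : n + i < m
  · rw [if_pos hi, if_pos (by omega), shift_iterate_apply]
  · rw [if_neg hi, if_neg (by omega)]
    exact congrArg y (by omega)

theorem splice_splice (m l : ℕ) (x e z : Seqs M) :
    splice m x (splice l e z) = splice (m + l) (splice m x e) z := by
  funext i
  unfold splice
  by_cases h1 : i < m
  · simp [h1, Nat.lt_add_right l h1]
  · by_cases h2 : i < m + l
    · rw [if_neg h1, if_pos (by omega), if_pos h2, if_neg h1]
    · rw [if_neg h1, if_neg (by omega), if_neg h2]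
      exact congrArg z (by omega)

theorem reflect_splice (m : ℕ) (x y : Seqs M) :
    reflect (splice m x y) = splice m (reflect x) (reflect y) := by
  funext i
  by_cases h : i < m
  · simp [splice, h]
  · simp [splice, h]

/-! ### The lexicographic order -/

theorem lexLT_iff {x y : Seqs M} : LexLT x y ↔ ∃ n, (∀ i < n, x i = y i) ∧ x n < y n := Iff.rfl

theorem not_lexLT {x y : Seqs M} : ¬ LexLT x y ↔ LexLE y x := not_lt

theorem not_lexLE {x y : Seqs M} : ¬ LexLE x y ↔ LexLT y x := not_le

theorem lexLE_iff {x y : Seqs M} : LexLE x y ↔ ∀ n, (∀ i < n, x i = y i) → x n ≤ y n := by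
  rw [← not_lexLT, lexLT_iff]
  push Not
  exact forall_congr' fun n => by simp only [eq_comm]

theorem LexLE.refl (x : Seqs M) : LexLE x x := le_refl (toLex x)

theorem LexLT.le {x y : Seqs M} (h : LexLT x y) : LexLE x y := le_of_lt h

theorem LexLE.trans {x y z : Seqs M} (h : LexLE x y) (h' : LexLE y z) : LexLE x z := le_trans h h'

theorem LexLE.antisymm {x y : Seqs M} (h : LexLE x y) (h' : LexLE y x) : x = y :=
  toLex.injective (le_antisymm h h')

theorem lexLE_total (x y : Seqs M) : LexLE x y ∨ LexLE y x := le_total _ _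

theorem lexLT_trichotomy (x y : Seqs M) : LexLT x y ∨ x = y ∨ LexLT y x := by
  rcases lt_trichotomy (toLex x) (toLex y) with h | h | h
  · exact Or.inl h
  · exact Or.inr (Or.inl (toLex.injective h))
  · exact Or.inr (Or.inr h)

theorem LexLE.apply_zero {x y : Seqs M} (h : LexLE x y) : x 0 ≤ y 0 :=
  lexLE_iff.1 h 0 (by simp)

theorem LexLE.apply_one {x y : Seqs M} (h : LexLE x y) (h0 : x 0 = y 0) : x 1 ≤ y 1 :=
  lexLE_iff.1 h 1 (by intro i hi; obtain rfl : i = 0 := by omega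
                      exact h0)

theorem lexLT_of_zero {x y : Seqs M} (h : x 0 < y 0) : LexLT x y :=
  lexLT_iff.2 ⟨0, by simp, h⟩

theorem lexLT_of_one {x y : Seqs M} (h0 : x 0 = y 0) (h : x 1 < y 1) : LexLT x y :=
  lexLT_iff.2 ⟨1, by intro i hi; obtain rfl : i = 0 := by omega
                     exact h0, h⟩

theorem lexLE_reflect {x y : Seqs M} : LexLE (reflect x) (reflect y) ↔ LexLE y x := by
  rw [lexLE_iff, lexLE_iff]
  refine forall_congr' fun n => ?_
  simp only [reflect_apply, Fin.rev_le_rev, Fin.rev_inj, eq_comm]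

theorem lexLT_reflect {x y : Seqs M} : LexLT (reflect x) (reflect y) ↔ LexLT y x := by
  rw [← not_lexLE, ← not_lexLE, lexLE_reflect]

/-- `x` is strictly smaller than `y`, and this is decided by the first `m` symbols. -/
def PrefixLT (m : ℕ) (x y : Seqs M) : Prop := ∃ n < m, (∀ i < n, x i = y i) ∧ x n < y n

theorem PrefixLT.lexLT {m : ℕ} {x y : Seqs M} (h : PrefixLT m x y) : LexLT x y := by
  obtain ⟨n, -, h⟩ := h
  exact lexLT_iff.2 ⟨n, h⟩

theorem PrefixLT.congr_left {m : ℕ} {x x' y : Seqs M} (h : PrefixLT m x y)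
    (hx : ∀ i < m, x' i = x i) : PrefixLT m x' y := by
  obtain ⟨n, hn, h1, h2⟩ := h
  exact ⟨n, hn, fun i hi => by rw [hx i (by omega), h1 i hi], by rwa [hx n hn]⟩

theorem PrefixLT.congr_right {m : ℕ} {x y y' : Seqs M} (h : PrefixLT m x y)
    (hy : ∀ i < m, y' i = y i) : PrefixLT m x y' := by
  obtain ⟨n, hn, h1, h2⟩ := h
  exact ⟨n, hn, fun i hi => by rw [hy i (by omega), h1 i hi], by rwa [hy n hn]⟩

theorem LexLE.agree_or_prefixLT {x y : Seqs M} (h : LexLE x y) (m : ℕ) :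
    (∀ i < m, x i = y i) ∨ PrefixLT m x y := by
  by_cases hx : ∀ i < m, x i = y i
  · exact Or.inl hx
  · right
    push Not at hx
    classical
    have hs := Nat.find_spec hx
    have hmin : ∀ i < Nat.find hx, x i = y i := fun i hi => by
      by_contra hne
      exact Nat.find_min hx hi ⟨by omega, hne⟩
    exact ⟨Nat.find hx, hs.1, hmin, lt_of_le_of_ne (lexLE_iff.1 h _ hmin) hs.2⟩

theorem LexLE.shift_of_agree {x y : Seqs M} {m : ℕ} (h : LexLE x y) (hm : ∀ i < m, x i = y i) :
    LexLE (shift^[m] x) (shift^[m] y) := by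
  rw [lexLE_iff] at h ⊢
  intro n hn
  simp only [shift_iterate_apply] at hn ⊢
  refine h (m + n) fun i hi => ?_
  by_cases him : i < m
  · exact hm i him
  · have := hn (i - m) (by omega)
    rwa [show m + (i - m) = i by omega] at this

theorem lexLE_of_agree {x y : Seqs M} {m : ℕ} (hm : ∀ i < m, x i = y i)
    (h : LexLE (shift^[m] x) (shift^[m] y)) : LexLE x y := by
  rcases lexLE_total x y with h1 | h1
  · exact h1
  · have h2 := (h1.shift_of_agree (fun i hi => (hm i hi).symm)).antisymm h
    have : x = y := by
      funext i
      by_cases hi : i < m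
      · exact hm i hi
      · have := congrFun h2 (i - m)
        simp only [shift_iterate_apply] at this
        rw [show m + (i - m) = i by omega] at this
        exact this.symm
    rw [this]; exact LexLE.refl _

/-- The order condition is an intersection of conditions on finitely many coordinates each, and such
conditions are clopen. -/
theorem isClosed_lexLE_left (b : Seqs M) : IsClosed {x : Seqs M | LexLE b x} := by
  have : {x : Seqs M | LexLE b x} =
      ⋂ n, {x | (∀ i < n, b i = x i) → b n ≤ x n} := by
    ext x; simp [lexLE_iff]
  rw [this]
  refine isClosed_iInter fun n => ?_
  have h2 : {x : Seqs M | (∀ i < n, b i = x i) → b n ≤ x n} =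
      (⋂ i ∈ Finset.range n, {x : Seqs M | x i = b i})ᶜ ∪ {x | b n ≤ x n} := by
    ext x
    simp only [Set.mem_ofPred_eq, Set.mem_union, Set.mem_compl_iff, Set.mem_iInter,
      Finset.mem_range, imp_iff_not_or, eq_comm]
  rw [h2]
  refine IsClosed.union ?_ ?_
  · rw [isClosed_compl_iff]
    refine isOpen_biInter_finset fun i _ => ?_
    have hi : Continuous fun x : Seqs M => x i := continuous_apply i
    exact (isOpen_discrete ({b i} : Set (Fin (M + 1)))).preimage hi
  · have hn : Continuous fun x : Seqs M => x n := continuous_apply n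
    exact (isClosed_discrete (Set.Ici (b n))).preimage hn

theorem continuous_reflect : Continuous (reflect : Seqs M → Seqs M) :=
  continuous_pi fun i => (continuous_of_discreteTopology (f := Fin.rev)).comp (continuous_apply i)

theorem continuous_shift : Continuous (shift : Seqs M → Seqs M) :=
  continuous_pi fun i => continuous_apply (i + 1)

theorem isClosed_lexLE_right (b : Seqs M) : IsClosed {x : Seqs M | LexLE x b} := by
  have : {x : Seqs M | LexLE x b} = reflect ⁻¹' {x | LexLE (reflect b) x} := by
    ext x; simp [lexLE_reflect]
  rw [this]
  exact (isClosed_lexLE_left _).preimage continuous_reflect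

/-! ### The shift bounded by a sequence and its reflection -/

/-- The sequences all of whose shifts lie between `reflect a` and `a`. -/
def box (a : Seqs M) : Set (Seqs M) :=
  {x | ∀ n : ℕ, LexLE (reflect a) (shift^[n] x) ∧ LexLE (shift^[n] x) a}

theorem box_shift_iterate {a x : Seqs M} (hx : x ∈ box a) (n : ℕ) : shift^[n] x ∈ box a := by
  intro m
  rw [shift_iterate_add]
  exact hx _

theorem box_reflect {a x : Seqs M} (hx : x ∈ box a) : reflect x ∈ box a := by
  intro n
  rw [← reflect_shift_iterate, lexLE_reflect]
  refine ⟨(hx n).2, ?_⟩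
  rw [← lexLE_reflect, reflect_reflect]
  exact (hx n).1

theorem box_le {a x : Seqs M} (hx : x ∈ box a) : LexLE x a := (hx 0).2

theorem le_box {a x : Seqs M} (hx : x ∈ box a) : LexLE (reflect a) x := (hx 0).1

theorem box_apply_le {a x : Seqs M} (hx : x ∈ box a) (n : ℕ) : x n ≤ a 0 := by
  have := (hx n).2.apply_zero
  rwa [shift_iterate_apply] at this

theorem le_box_apply {a x : Seqs M} (hx : x ∈ box a) (n : ℕ) : (a 0).rev ≤ x n := by
  have := (hx n).1.apply_zero
  rwa [shift_iterate_apply] at this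

theorem isClosed_box (a : Seqs M) : IsClosed (box a) := by
  have : box a = ⋂ n, ((shift^[n] : Seqs M → Seqs M) ⁻¹' ({x | LexLE (reflect a) x} ∩
      {x | LexLE x a})) := by
    ext x; simp [box]
  rw [this]
  exact isClosed_iInter fun n => ((isClosed_lexLE_left _).inter (isClosed_lexLE_right _)).preimage
    (continuous_shift.iterate n)

theorem isSubshift_box {a : Seqs M} (h : (box a).Nonempty) : IsSubshift (box a) :=
  ⟨h, isClosed_box a, fun _ hx => box_shift_iterate hx 1⟩

/-- A spliced sequence lies in the box of `a` if its tail does and the bounds hold at the shifts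
that start before the tail. -/
theorem splice_mem_box {a x y : Seqs M} {m : ℕ} (hy : y ∈ box a)
    (h : ∀ n < m, LexLE (reflect a) (splice (m - n) (shift^[n] x) y) ∧
      LexLE (splice (m - n) (shift^[n] x) y) a) : splice m x y ∈ box a := by
  intro n
  by_cases hn : n < m
  · rw [shift_iterate_splice hn.le]; exact h n hn
  · obtain ⟨k, rfl⟩ := Nat.exists_eq_add_of_le (not_lt.1 hn)
    rw [shift_iterate_splice_add]
    exact hy k

/-- A non-empty box is the box of its largest element. -/
theorem exists_box_eq {a : Seqs M} (h : (box a).Nonempty) :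
    ∃ b ∈ seqV M, b ∈ box a ∧ box a = box b := by
  have hne : Nonempty (box a) := h.to_subtype
  -- The order is total, so the closed sets of elements above a given one form a chain; by
  -- compactness they have a common point, the largest element.
  have key : (⋂ y : box a, (box a ∩ {x | LexLE (y : Seqs M) x})).Nonempty := by
    apply IsCompact.nonempty_iInter_of_directed_nonempty_isCompact_isClosed
    · intro y z
      rcases lexLE_total (y : Seqs M) z with hyz | hyz
      · exact ⟨z, fun x hx => ⟨hx.1, hyz.trans hx.2⟩, fun x hx => hx⟩
      · exact ⟨y, fun x hx => hx, fun x hx => ⟨hx.1, hyz.trans hx.2⟩⟩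
    · exact fun y => ⟨y, y.2, LexLE.refl _⟩
    · exact fun y => ((isClosed_box a).inter (isClosed_lexLE_left _)).isCompact
    · exact fun y => (isClosed_box a).inter (isClosed_lexLE_left _)
  obtain ⟨b, hb⟩ := key
  rw [Set.mem_iInter] at hb
  have hba : b ∈ box a := (hb hne.some).1
  have hmax : ∀ x ∈ box a, LexLE x b := fun x hx => (hb ⟨x, hx⟩).2
  -- The box is invariant under reflection, so the reflection of its largest element is its
  -- smallest.
  have hmin : ∀ x ∈ box a, LexLE (reflect b) x := fun x hx => by
    rw [← lexLE_reflect, reflect_reflect]; exact hmax _ (box_reflect hx)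
  have hsub : box a ⊆ box b := fun x hx n =>
    ⟨hmin _ (box_shift_iterate hx n), hmax _ (box_shift_iterate hx n)⟩
  refine ⟨b, hsub hba, hba, hsub.antisymm fun x hx n => ⟨?_, (hx n).2.trans (box_le hba)⟩⟩
  exact (lexLE_reflect.2 (box_le hba)).trans (hx n).1

/-! ### Mixing and languages -/

theorem prefix_mem_language {X : Set (Seqs M)} {x : Seqs M} (hx : x ∈ X) (k n : ℕ) :
    List.ofFn (fun i : Fin n => x (k + i)) ∈ admissibleWords X n :=
  ⟨by simp, x, hx, k, fun i => by simp⟩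

theorem language_iff {X : Set (Seqs M)} (hX : Set.MapsTo shift X X) {u : List (Fin (M + 1))} :
    u ∈ language X ↔ ∃ x ∈ X, ∀ i (h : i < u.length), u[i] = x i := by
  constructor
  · intro h
    obtain ⟨n, hn, x, hx, k, hk⟩ := Set.mem_iUnion.1 h
    refine ⟨shift^[k] x, hX.iterate k hx, fun i hi => ?_⟩
    rw [shift_iterate_apply]
    exact hk ⟨i, hi⟩
  · rintro ⟨x, hx, h⟩
    exact Set.mem_iUnion.2 ⟨u.length, rfl, x, hx, 0, fun i => by simpa using h i i.2⟩

/-- A criterion for mixing: the elements of `Q` can be freely attached to suitable extensions of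
each word, and there are words of every large length that map `Q` into `Q`. -/
theorem isMixingSubshift_of_connecting {X Q : Set (Seqs M)} (hX : IsSubshift X)
    (h1 : ∀ x ∈ X, ∀ N, ∃ (e : Seqs M) (l : ℕ), N ≤ l ∧ (∀ i < N, e i = x i) ∧
      ∀ z ∈ Q, splice l e z ∈ X)
    (h2 : ∀ z ∈ X, ∃ (t : Seqs M) (l : ℕ), splice l t z ∈ Q)
    (h3 : ∃ N, ∀ n, N ≤ n → ∃ f : Seqs M, ∀ z ∈ Q, splice n f z ∈ Q) :
    IsMixingSubshift X := by
  refine ⟨hX, fun u hu v hv => ?_⟩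
  obtain ⟨x, hx, hxu⟩ := (language_iff hX.2.2).1 hu
  obtain ⟨y, hy, hyv⟩ := (language_iff hX.2.2).1 hv
  obtain ⟨e, l, hl, hex, he⟩ := h1 x hx u.length
  obtain ⟨t, l', ht⟩ := h2 y hy
  obtain ⟨N, hN⟩ := h3
  refine ⟨N + l + l', fun n hn => ?_⟩
  -- The extension of u has length l and the word in front of y has length l'; s is the length left
  -- for the filler word between them.
  obtain ⟨s, hs⟩ : ∃ s, n + u.length = l + (s + l') := ⟨n + u.length - l - l', by omega⟩
  obtain ⟨f, hf⟩ := hN s (by omega)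
  set P := splice l e (splice s f (splice l' t y)) with hP
  have hPX : P ∈ X := he _ (hf _ ht)
  have hPu : ∀ i < u.length, P i = x i := fun i hi => by
    rw [hP, splice_of_lt (by omega), hex i hi]
  have hPv : ∀ i, P (u.length + n + i) = y i := fun i => by
    rw [hP, splice_splice s, splice_splice l, show u.length + n + i = l + (s + l') + i by omega,
      splice_add]
  refine ⟨_, prefix_mem_language hPX u.length n, (language_iff hX.2.2).2 ⟨P, hPX, fun i hi => ?_⟩⟩
  simp only [List.length_append, List.length_ofFn] at hi
  rw [List.getElem_append]
  split_ifs with h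
  · rw [List.getElem_append]
    split_ifs with h'
    · rw [hxu i h', hPu i h']
    · simp only [List.getElem_ofFn]
      exact congrArg P (by omega)
  · simp only [List.length_append, List.length_ofFn] at h ⊢
    rw [hyv _ (by omega), ← hPv]
    exact congrArg P (by omega)

/-! ### Lowered prefixes -/

/-- The sequence `(a_1 … a_{n+1}⁻)^∞`. -/
def lowered (a : Seqs M) (n : ℕ) : Seqs M := wordRepeat (wordMinus (prefixWord a (n + 1)))

theorem lowered_of_lt {n i : ℕ} (a : Seqs M) (h : i < n) : lowered a n i = a i := by
  have h1 : i % (n + 1) = i := Nat.mod_eq_of_lt (by omega)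
  have h2 : (⟨i, by omega⟩ : Fin (n + 1)) ≠ Fin.last n := by
    simp [Fin.ext_iff]; omega
  simp [lowered, wordRepeat, wordMinus, prefixWord, h1, Function.update_of_ne h2]

theorem lowered_last (a : Seqs M) (n : ℕ) : (lowered a n n : ℕ) = a n - 1 := by
  have h1 : n % (n + 1) = n := Nat.mod_eq_of_lt (by omega)
  have h2 : (⟨n, by omega⟩ : Fin (n + 1)) = Fin.last n := rfl
  simp [lowered, wordRepeat, wordMinus, prefixWord, h1, h2]

theorem lowered_mod (a : Seqs M) (n i : ℕ) : lowered a n (i % (n + 1)) = lowered a n i := by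
  simp [lowered, wordRepeat]

theorem lowered_add (a : Seqs M) (n i : ℕ) : lowered a n (n + 1 + i) = lowered a n i := by
  rw [← lowered_mod, Nat.add_mod_left, lowered_mod]

theorem shift_iterate_lowered (a : Seqs M) (n : ℕ) :
    shift^[n + 1] (lowered a n) = lowered a n := by
  funext i; rw [shift_iterate_apply, lowered_add]

theorem shift_iterate_lowered_mod (a : Seqs M) (n k : ℕ) :
    shift^[k % (n + 1)] (lowered a n) = shift^[k] (lowered a n) := by
  funext i
  rw [shift_iterate_apply, shift_iterate_apply, ← lowered_mod, ← lowered_mod a n (k + i)]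
  congr 1
  simp [Nat.add_mod]

/-- The reflection of the repeated raised word in the definition of irreducibility. -/
theorem wordRepeat_wordPlus {a : Seqs M} {n : ℕ} (h : 0 < a n) :
    wordRepeat (wordPlus (reflectWord (prefixWord a (n + 1)))) = reflect (lowered a n) := by
  have key : wordPlus (reflectWord (prefixWord a (n + 1))) =
      reflectWord (wordMinus (prefixWord a (n + 1))) := by
    funext i
    by_cases hi : i = Fin.last n
    · subst hi
      have h1 : 0 < (a n : ℕ) := h
      have h2 := (a n).2
      apply Fin.ext
      simp [wordPlus, wordMinus, reflectWord, prefixWord, Fin.val_rev]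
      omega
    · simp [wordPlus, wordMinus, reflectWord, Function.update_of_ne hi]
  rw [key]
  rfl

theorem wordAppend_prefixWord (a x : Seqs M) (n : ℕ) :
    wordAppend (prefixWord a n) x = splice n a x := by
  funext i
  by_cases h : i < n
  · simp [wordAppend, splice, prefixWord, h]
  · simp [wordAppend, splice, h]

theorem isIrreducibleSeq_iff {a : Seqs M} : IsIrreducibleSeq a ↔ a ∈ seqV M ∧ ∀ n, 0 < a n →
    lowered a n ∈ seqV M → LexLT (splice (n + 1) a (reflect (lowered a n))) a := by
  refine and_congr_right fun _ => forall_congr' fun n => ?_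
  refine forall_congr' fun h => forall_congr' fun _ => ?_
  rw [wordRepeat_wordPlus h, wordAppend_prefixWord]

/-- No non-empty suffix of `a_1 … a_m` is the reflection of a prefix of `a`. -/
def NoReflectedSuffix (a : Seqs M) (m : ℕ) : Prop :=
  ∀ i < m, ∃ t, i + t < m ∧ a (i + t) ≠ (a t).rev

/-- The last symbol alone is a suffix, so it differs from the reflection of `a 0`, which is the
least symbol allowed. -/
theorem NoReflectedSuffix.pos {a : Seqs M} {n : ℕ} (ha : a ∈ seqV M)
    (h : NoReflectedSuffix a (n + 1)) : 0 < a n := by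
  obtain ⟨t, ht, hne⟩ := h n (by omega)
  obtain rfl : t = 0 := by omega
  exact lt_of_le_of_lt (Fin.zero_le _) (lt_of_le_of_ne (le_box_apply ha n) (Ne.symm hne))

theorem NoReflectedSuffix.prefixLT {a : Seqs M} {m i : ℕ} (ha : a ∈ seqV M)
    (h : NoReflectedSuffix a m) (hi : i < m) : PrefixLT (m - i) (reflect a) (shift^[i] a) := by
  rcases (ha i).1.agree_or_prefixLT (m - i) with h1 | h1
  · obtain ⟨t, ht, hne⟩ := h i hi
    refine absurd ?_ hne
    rw [← shift_iterate_apply _ a, ← h1 t (by omega), reflect_apply]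
  · exact h1

/-- Lowering the last symbol makes all suffixes strictly smaller than the prefixes of `a`. -/
theorem prefixLT_lowered {a : Seqs M} {n j : ℕ} (ha : a ∈ seqV M) (hpos : 0 < a n) (hj : j ≤ n) :
    PrefixLT (n + 1 - j) (shift^[j] (lowered a n)) a := by
  have hlast : lowered a n n < a n := by
    have h1 : 0 < (a n : ℕ) := hpos
    rw [Fin.lt_def, lowered_last]; omega
  rcases (ha j).2.agree_or_prefixLT (n - j) with h | ⟨t, ht, h1, h2⟩
  · refine ⟨n - j, by omega, fun i hi => ?_, ?_⟩
    · rw [shift_iterate_apply, lowered_of_lt a (by omega), ← shift_iterate_apply _ a, h i hi]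
    · rw [shift_iterate_apply, show j + (n - j) = n by omega]
      refine hlast.trans_le ?_
      have := lexLE_iff.1 (ha j).2 (n - j) h
      rwa [shift_iterate_apply, show j + (n - j) = n by omega] at this
  · refine ⟨t, by omega, fun i hi => ?_, ?_⟩
    · rw [shift_iterate_apply, lowered_of_lt a (by omega), ← shift_iterate_apply _ a, h1 i hi]
    · rw [shift_iterate_apply, lowered_of_lt a (by omega), ← shift_iterate_apply _ a]; exact h2

/-- A suffix of the lowered word is strictly larger than the prefix of the reflection of `a`, or
equal to it. -/
theorem lowered_dichotomy {a : Seqs M} {n j : ℕ} (ha : a ∈ seqV M)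
    (h : NoReflectedSuffix a (n + 1)) (hj : j ≤ n) :
    PrefixLT (n + 1 - j) (reflect a) (shift^[j] (lowered a n)) ∨
      ∀ t, j + t ≤ n → lowered a n (j + t) = (a t).rev := by
  obtain ⟨t, ht, h1, h2⟩ := h.prefixLT ha (i := j) (by omega)
  have h1' : ∀ i < t, lowered a n (j + i) = (a i).rev := fun i hi => by
    rw [lowered_of_lt a (by omega), ← shift_iterate_apply _ a, ← h1 i hi, reflect_apply]
  by_cases htn : j + t < n
  · refine Or.inl ⟨t, ht, fun i hi => ?_, ?_⟩
    · rw [shift_iterate_apply, h1' i hi, reflect_apply]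
    · rwa [shift_iterate_apply, lowered_of_lt a htn, ← shift_iterate_apply _ a]
  · have hjt : j + t = n := by omega
    rw [shift_iterate_apply, hjt, reflect_apply] at h2
    have h3 : (a t).rev ≤ lowered a n n := by
      rw [Fin.le_def, lowered_last]; rw [Fin.lt_def] at h2; omega
    rcases h3.lt_or_eq with h4 | h4
    · refine Or.inl ⟨t, ht, fun i hi => ?_, ?_⟩
      · rw [shift_iterate_apply, h1' i hi, reflect_apply]
      · rwa [shift_iterate_apply, hjt]
    · refine Or.inr fun i hi => ?_
      rcases (show i < t ∨ i = t by omega) with h5 | rfl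
      · exact h1' i h5
      · rw [hjt, h4]

/-- This makes irreducibility applicable at the word. The last hypothesis rules out the single
letter with 2 * `a 0` = M + 1, whose lowered repetition lies below its own reflection. -/
theorem lowered_mem_seqV {a : Seqs M} {n : ℕ} (ha : a ∈ seqV M) (h0 : (a 0).rev < a 0)
    (h : NoReflectedSuffix a (n + 1)) (hn : 1 ≤ n ∨ M + 2 ≤ 2 * (a 0 : ℕ)) :
    lowered a n ∈ seqV M := by
  have hpos := h.pos ha
  intro k
  rw [← shift_iterate_lowered_mod]
  have hk : k % (n + 1) ≤ n := Nat.lt_succ_iff.1 (Nat.mod_lt _ (by omega))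
  set j := k % (n + 1)
  rcases Nat.eq_zero_or_pos j with hj0 | hj0
  · rw [hj0]
    refine ⟨?_, LexLE.refl _⟩
    rcases Nat.eq_zero_or_pos n with rfl | hn0
    · have h1 : ∀ i, lowered a 0 i = lowered a 0 0 := fun i => by
        rw [← lowered_mod]; simp [Nat.mod_one]
      have h2 : (lowered a 0 0).rev ≤ lowered a 0 0 := by
        rw [Fin.le_def, Fin.val_rev, lowered_last]; omega
      rw [lexLE_iff]
      intro i _
      simp only [Function.iterate_zero, id_eq]
      rw [reflect_apply, h1]
      exact h2
    · apply LexLT.le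
      apply lexLT_of_zero
      rw [reflect_apply, Function.iterate_zero, id_eq, lowered_of_lt a hn0]
      exact h0
  · constructor
    · have hstrict : ∀ i, 1 ≤ i → i ≤ n →
          (PrefixLT (n + 1 - i) (reflect (lowered a n)) (shift^[i] (lowered a n))) ∨
            ∀ t, i + t ≤ n → lowered a n (i + t) = (lowered a n t).rev := by
        intro i hi1 hin
        rcases lowered_dichotomy ha h hin with h1 | h1
        · refine Or.inl (PrefixLT.congr_left h1 fun t ht => ?_)
          rw [reflect_apply, reflect_apply, lowered_of_lt a (by omega)]
        · refine Or.inr fun t ht => ?_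
          rw [h1 t ht, lowered_of_lt a (by omega)]
      rcases hstrict j hj0 hk with h1 | h1
      · exact h1.lexLT.le
      -- The suffix from j is a reflected prefix, so the comparison moves into the next period.
      -- Reflected, it becomes the comparison for the suffix from n + 1 - j: it is strict, or the
      -- shift by j equals the reflection of the whole sequence.
      · rcases hstrict (n + 1 - j) (by omega) (by omega) with h2 | h2
        · obtain ⟨t, ht, h3, h4⟩ := h2
          refine (lexLT_iff.2 ⟨n + 1 - j + t, fun i hi => ?_, ?_⟩).le
          · by_cases hi' : i < n + 1 - j
            · rw [shift_iterate_apply, h1 i (by omega), reflect_apply]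
            · obtain ⟨s, rfl⟩ := Nat.exists_eq_add_of_le (not_lt.1 hi')
              have := h3 s (by omega)
              rw [reflect_apply, shift_iterate_apply] at this
              rw [shift_iterate_apply, show j + (n + 1 - j + s) = n + 1 + s by omega, lowered_add,
                reflect_apply, ← this, Fin.rev_rev]
          · rw [reflect_apply, shift_iterate_apply] at h4
            rw [shift_iterate_apply, show j + (n + 1 - j + t) = n + 1 + t by omega, lowered_add,
              reflect_apply, Fin.rev_lt_iff]
            exact h4
        · have heq : ∀ t < n + 1, lowered a n (j + t) = (lowered a n t).rev := fun t ht => by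
            by_cases hi' : t < n + 1 - j
            · exact h1 t (by omega)
            · obtain ⟨s, rfl⟩ := Nat.exists_eq_add_of_le (not_lt.1 hi')
              rw [h2 s (by omega), show j + (n + 1 - j + s) = n + 1 + s by omega, lowered_add,
                Fin.rev_rev]
          have : shift^[j] (lowered a n) = reflect (lowered a n) := by
            funext t
            rw [shift_iterate_apply, reflect_apply, ← lowered_mod a n t,
              ← heq _ (Nat.mod_lt _ (by omega)), ← lowered_mod a n (j + t),
              ← lowered_mod a n (j + t % (n + 1))]
            congr 1
            simp [Nat.add_mod]
          rw [this]
          exact LexLE.refl _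
    · refine (PrefixLT.lexLT ((prefixLT_lowered ha hpos hk).congr_right fun i hi => ?_)).le
      exact lowered_of_lt a (by omega)

/-- A sequence in the box of `a` that starts with a lowered word stays in the box if that word is
put in front once more. -/
theorem splice_lowered_mem_box {a y : Seqs M} {n : ℕ} (ha : a ∈ seqV M) (hpos : 0 < a n)
    (hc : lowered a n ∈ seqV M) (hy : y ∈ box a) (hyc : ∀ i ≤ n, y i = lowered a n i) :
    splice (n + 1) (lowered a n) y ∈ box a := by
  refine splice_mem_box hy fun j hj => ⟨?_, ?_⟩
  · have hagree : ∀ i ≤ n, splice (n + 1 - j) (shift^[j] (lowered a n)) y i =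
        shift^[j] (lowered a n) i := fun i hi => by
      by_cases h : i < n + 1 - j
      · rw [splice_of_lt h]
      · obtain ⟨s, rfl⟩ := Nat.exists_eq_add_of_le (not_lt.1 h)
        rw [splice_add, hyc s (by omega), shift_iterate_apply,
          show j + (n + 1 - j + s) = n + 1 + s by omega, lowered_add]
    have hlast : (a n).rev < (lowered a n n).rev := by
      rw [Fin.rev_lt_rev, Fin.lt_def, lowered_last]
      have h1 : 0 < (a n : ℕ) := hpos
      omega
    apply LexLT.le
    apply PrefixLT.lexLT (m := n + 1)
    refine PrefixLT.congr_right ?_ fun i hi => hagree i (by omega)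
    -- The shifts of the lowered sequence dominate its own reflection, which exceeds `reflect a` at
    -- index n. So n + 1 symbols decide the bound, and these are known because y begins with the
    -- lowered word.
    rcases (hc j).1.agree_or_prefixLT n with h | ⟨t, ht, h1, h2⟩
    · refine ⟨n, by omega, fun i hi => ?_, ?_⟩
      · rw [← h i hi, reflect_apply, reflect_apply, lowered_of_lt a hi]
      · exact hlast.trans_le (lexLE_iff.1 (hc j).1 n h)
    · refine ⟨t, by omega, fun i hi => ?_, ?_⟩
      · rw [← h1 i hi, reflect_apply, reflect_apply, lowered_of_lt a (by omega)]
      · rwa [reflect_apply, lowered_of_lt a ht] at h2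
  · refine (PrefixLT.lexLT ((prefixLT_lowered ha hpos (j := j) (by omega)).congr_left
      fun i hi => ?_)).le
    rw [splice_of_lt hi]

theorem splice_lowered_repeat_mem_box {a y : Seqs M} {n : ℕ} (ha : a ∈ seqV M) (hpos : 0 < a n)
    (hc : lowered a n ∈ seqV M) (hy : splice (n + 1) (lowered a n) y ∈ box a) (N : ℕ) :
    splice ((n + 1) * (N + 1)) (lowered a n) y ∈ box a := by
  have hstep : ∀ k, splice (n + 1) (lowered a n) (splice k (lowered a n) y) =
      splice (n + 1 + k) (lowered a n) y := fun k => by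
    rw [splice_splice]
    funext i
    by_cases h : i < n + 1 + k
    · rw [splice_of_lt h, splice_of_lt h]
      by_cases h' : i < n + 1
      · rw [splice_of_lt h']
      · obtain ⟨s, rfl⟩ := Nat.exists_eq_add_of_le (not_lt.1 h')
        rw [splice_add, lowered_add]
    · rw [splice_of_le (not_lt.1 h), splice_of_le (not_lt.1 h)]
  induction N with
  | zero => simpa using hy
  | succ N ih =>
    have : (n + 1) * (N + 1 + 1) = n + 1 + (n + 1) * (N + 1) := by ring
    rw [this, ← hstep]
    refine splice_lowered_mem_box ha hpos hc ih fun i hi => splice_of_lt ?_ _ _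
    nlinarith

/-! ### Leaving a prefix of an irreducible sequence -/

/-- The sequences of the box of `a` whose first symbol is not the least possible one. -/
def openBox (a : Seqs M) : Set (Seqs M) := {z | z ∈ box a ∧ (a 0).rev < z 0}

/-- A reflected suffix of the prefix, reflected once more, would be a suffix of the lowered word
equal to a prefix of `a`; but such suffixes are strictly smaller. -/
theorem noReflectedSuffix_of_suffix {a : Seqs M} {n i : ℕ} (ha : a ∈ seqV M) (hpos : 0 < a n)
    (hi : i ≤ n) (h : ∀ t, i + t ≤ n → lowered a n (i + t) = (a t).rev) :
    NoReflectedSuffix a (n - i + 1) := by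
  intro k hk
  by_contra! hcon
  have h1 : PrefixLT (n + 1 - (i + k)) (shift^[i + k] (lowered a n)) a :=
    prefixLT_lowered ha hpos (by omega)
  obtain ⟨t, ht, -, h2⟩ := h1
  rw [shift_iterate_apply, add_assoc, h _ (by omega), hcon t (by omega), Fin.rev_rev] at h2
  exact lt_irrefl _ h2

/-- The induction step of the whole argument: the longest suffix of the lowered word that is a
reflected prefix ū is made harmless by many copies of u⁻. That the continuation itself lies in the
box is part of the claim, since it is the tail after the copies. -/
theorem exists_continuation {a : Seqs M} (hirr : IsIrreducibleSeq a) (h0 : (a 0).rev < a 0)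
    (hB : 2 * (a 0 : ℕ) = M + 1 → a 1 = a 0) (n : ℕ) (hn : NoReflectedSuffix a (n + 1)) :
    ∃ (e : Seqs M) (l : ℕ), ∀ z ∈ openBox a, splice l e z ∈ box a ∧
      splice (n + 1) (lowered a n) (splice l e z) ∈ box a := by
  have ha := hirr.1
  induction n using Nat.strong_induction_on with
  | _ n ih =>
  have hpos := hn.pos ha
  have hupper : ∀ (z : Seqs M), ∀ j < n + 1,
      LexLE (splice (n + 1 - j) (shift^[j] (lowered a n)) z) a := fun z j hj =>
    (PrefixLT.lexLT ((prefixLT_lowered ha hpos (j := j) (by omega)).congr_left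
      fun i hi => splice_of_lt hi _ _)).le
  have hlower : ∀ (z : Seqs M) (j), j < n + 1 →
      (∃ t, j + t ≤ n ∧ lowered a n (j + t) ≠ (a t).rev) →
      LexLE (reflect a) (splice (n + 1 - j) (shift^[j] (lowered a n)) z) := fun z j hj hne => by
    rcases lowered_dichotomy ha hn (j := j) (by omega) with h | h
    · exact (PrefixLT.lexLT (h.congr_right fun i hi => splice_of_lt hi _ _)).le
    · obtain ⟨t, ht, hne⟩ := hne
      exact absurd (h t ht) hne
  by_cases hex : ∃ i, i ≤ n ∧ ∀ t, i + t ≤ n → lowered a n (i + t) = (a t).rev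
  · classical
    obtain ⟨hin, hi⟩ := Nat.find_spec hex
    have hmin : ∀ j < Nat.find hex, ∃ t, j + t ≤ n ∧ lowered a n (j + t) ≠ (a t).rev := by
      intro j hj
      have := Nat.find_min hex hj
      push Not at this
      exact this (by omega)
    set i := Nat.find hex
    -- Irreducibility says nothing about a one-letter u when 2 * `a 0` = M + 1. Here z can follow at
    -- once: its first symbol exceeds the second symbol of `reflect a`, which equals the first by
    -- `hB`.
    by_cases hend : n = i ∧ 2 * (a 0 : ℕ) = M + 1
    · refine ⟨a, 0, fun z hz => ?_⟩
      rw [splice_zero]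
      refine ⟨hz.1, splice_mem_box hz.1 fun j hj => ⟨?_, hupper z j hj⟩⟩
      by_cases hj' : j < i
      · exact hlower z j hj (hmin j hj')
      · obtain rfl : j = n := by omega
        have := hi 0 (by omega)
        apply LexLT.le
        apply lexLT_of_one
        · rw [splice_of_lt (by omega), shift_iterate_apply, reflect_apply, ← this, hend.1]
        · rw [splice_of_le (by omega), reflect_apply, hB hend.2]
          simpa using hz.2
    · have hin0 : 0 < i := by
        by_contra hi0
        have hi0 : i = 0 := by omega
        have h1 := hi 0 (by omega)
        rw [hi0] at h1
        rcases Nat.eq_zero_or_pos n with rfl | hn0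
        · have h2 := lowered_last a 0
          rw [h1, Fin.val_rev] at h2
          have h3 := (a 0).2
          have h4 : 0 < (a 0 : ℕ) := hpos
          exact hend ⟨by omega, by omega⟩
        · rw [zero_add, lowered_of_lt a hn0] at h1
          exact h0.ne' h1
      have hlt : n - i < n := by omega
      have hD := noReflectedSuffix_of_suffix ha hpos hin hi
      obtain ⟨e, l, he⟩ := ih (n - i) hlt hD
      have hpos' := hD.pos ha
      have hc : lowered a (n - i) ∈ seqV M := by
        refine lowered_mem_seqV ha h0 hD ?_
        rw [Fin.lt_def, Fin.val_rev] at h0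
        omega
      have hred := (isIrreducibleSeq_iff.1 hirr).2 (n - i) hpos' hc
      set c := lowered a (n - i) with hcdef
      set r := n - i + 1 with hr
      rw [← lexLT_reflect, reflect_splice, reflect_reflect, lexLT_iff] at hred
      obtain ⟨p, hp1, hp2⟩ := hred
      -- The strict inequality from irreducibility is decided at index p; p + 1 copies of the
      -- lowered word reach beyond it.
      have hN : p < r * (p + 1) := by nlinarith
      refine ⟨splice (r * (p + 1)) c e, r * (p + 1) + l, fun z hz => ?_⟩
      obtain ⟨he1, he2⟩ := he z hz
      rw [← splice_splice]
      have hζ : splice (r * (p + 1)) c (splice l e z) ∈ box a :=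
        splice_lowered_repeat_mem_box ha hpos' hc he2 p
      have hζlt : LexLT (reflect a) (splice r (reflect a)
          (splice (r * (p + 1)) c (splice l e z))) := by
        have hagree : ∀ i ≤ p, splice r (reflect a) (splice (r * (p + 1)) c (splice l e z)) i =
            splice r (reflect a) c i := fun i hi => by
          by_cases hir : i < r
          · rw [splice_of_lt hir, splice_of_lt hir]
          · rw [splice_of_le (not_lt.1 hir), splice_of_le (not_lt.1 hir), splice_of_lt (by omega)]
        exact lexLT_iff.2 ⟨p, fun i hi => by rw [hagree i hi.le]; exact hp1 i hi,
          by rw [hagree p le_rfl]; exact hp2⟩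
      set ζ := splice (r * (p + 1)) c (splice l e z)
      refine ⟨hζ, splice_mem_box hζ fun j hj => ⟨?_, hupper ζ j hj⟩⟩
      by_cases hall : ∀ t, j + t ≤ n → lowered a n (j + t) = (a t).rev
      · have hij : i ≤ j := by
          by_contra hji
          obtain ⟨t, ht, hne⟩ := hmin j (by omega)
          exact hne (hall t ht)
        have h1 : LexLE (shift^[r] (reflect a)) ζ := by
          have := hζlt.le.shift_of_agree (m := r) fun i hi => (splice_of_lt hi _ _).symm
          rwa [shift_iterate_splice_self] at this
        -- Shorter reflected suffixes need no copies of their own: `reflect a` is the least among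
        -- its shifts, so the bound at i implies the one at j.
        have h2 : LexLE (shift^[n + 1 - j] (reflect a)) (shift^[r] (reflect a)) := by
          have h3 : LexLE (reflect a) (shift^[j - i] (reflect a)) := by
            rw [← reflect_shift_iterate, lexLE_reflect]; exact (ha _).2
          have h4 := h3.shift_of_agree (m := n + 1 - j) fun t ht => by
            rw [shift_iterate_apply, reflect_apply, reflect_apply, ← hall t (by omega),
              ← hi (j - i + t) (by omega)]
            congr 1; omega
          rw [shift_iterate_add] at h4
          rwa [show j - i + (n + 1 - j) = r by omega] at h4
        refine lexLE_of_agree (m := n + 1 - j) (fun t ht => ?_) ?_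
        · rw [splice_of_lt ht, shift_iterate_apply, hall t (by omega), reflect_apply]
        · rw [shift_iterate_splice_self]
          exact h2.trans h1
      · push Not at hall
        exact hlower ζ j hj hall
  · push Not at hex
    refine ⟨a, 0, fun z hz => ?_⟩
    rw [splice_zero]
    exact ⟨hz.1, splice_mem_box hz.1 fun j hj =>
      ⟨hlower z j hj (hex j (by omega)), hupper z j hj⟩⟩

/-- Take the longest reflected suffix of the prefix of length j + 1 and prolong the prefix until
that match breaks. A reflected suffix of the longer prefix could not start earlier, and starting
later it would force too small a symbol at the break. -/
theorem exists_noReflectedSuffix_of_ne {a : Seqs M} (ha : a ∈ seqV M)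
    (h : ∀ p, shift^[p] a ≠ reflect a) (j : ℕ) : ∃ n, j ≤ n ∧ NoReflectedSuffix a (n + 1) := by
  classical
  by_contra! hcon
  have hex : ∃ i, i ≤ j ∧ ∀ t, i + t ≤ j → a (i + t) = (a t).rev := by
    have := hcon j le_rfl
    unfold NoReflectedSuffix at this
    push Not at this
    obtain ⟨i, hi, h1⟩ := this
    exact ⟨i, by omega, fun t ht => h1 t (by omega)⟩
  obtain ⟨hij, hi⟩ := Nat.find_spec hex
  have hmin := fun k (hk : k < Nat.find hex) => Nat.find_min hex hk
  set i := Nat.find hex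
  have hlt : LexLT (reflect a) (shift^[i] a) :=
    lt_of_le_of_ne (ha i).1 fun he => h i (toLex.injective he).symm
  obtain ⟨t, h1, h2⟩ := lexLT_iff.1 hlt
  simp only [reflect_apply, shift_iterate_apply] at h1 h2
  have htj : j < i + t := by
    by_contra hle
    rw [hi t (by omega)] at h2
    exact lt_irrefl _ h2
  have := hcon (i + t) htj.le
  unfold NoReflectedSuffix at this
  push Not at this
  obtain ⟨k, hk, hk2⟩ := this
  have hik : i ≤ k := by
    by_contra hki
    exact hmin k (by omega) ⟨by omega, fun s hs => hk2 s (by omega)⟩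
  obtain ⟨d, rfl⟩ := Nat.exists_eq_add_of_le hik
  have h3 : LexLE (reflect a) (shift^[d] (reflect a)) := by
    rw [← reflect_shift_iterate, lexLE_reflect]; exact (ha _).2
  have h4 := lexLE_iff.1 h3 (t - d) fun s hs => by
    rw [shift_iterate_apply, reflect_apply, reflect_apply, h1 (d + s) (by omega), ← add_assoc,
      hk2 s (by omega)]
  have h5 := hk2 (t - d) (by omega)
  rw [shift_iterate_apply, reflect_apply, reflect_apply, show d + (t - d) = t by omega, ← h5,
    show i + d + (t - d) = i + t by omega] at h4
  exact absurd h2 (not_lt.2 h4)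

/-- An irreducible sequence is not of the form `σ^p a = reflect a`. -/
theorem shift_iterate_ne_reflect {a : Seqs M} (hirr : IsIrreducibleSeq a) (h0 : (a 0).rev < a 0)
    (hB : 2 * (a 0 : ℕ) = M + 1 → a 1 = a 0) (p : ℕ) : shift^[p] a ≠ reflect a := by
  classical
  intro hp
  have ha := hirr.1
  have hex : ∃ p, shift^[p] a = reflect a := ⟨p, hp⟩
  have hq := Nat.find_spec hex
  have hmin := fun k (hk : k < Nat.find hex) => Nat.find_min hex hk
  set q := Nat.find hex
  have hq0 : q ≠ 0 := by
    intro h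
    have := congrFun hq 0
    rw [h] at this
    exact h0.ne' this
  -- With the least such shift written n + 1, the sequence is w w̄ w w̄ … with w of length n + 1.
  -- Minimality keeps w free of reflected suffixes, and irreducibility at w fails because the
  -- reflection of w⁻ is larger than w̄.
  obtain ⟨n, hn⟩ := Nat.exists_eq_succ_of_ne_zero hq0
  rw [hn, Nat.succ_eq_add_one] at hq hmin
  have hper : ∀ i, a (n + 1 + i) = (a i).rev := fun i => by
    rw [← shift_iterate_apply _ a, hq, reflect_apply]
  have hD : NoReflectedSuffix a (n + 1) := by
    intro i hi
    by_contra! hcon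
    rcases Nat.eq_zero_or_pos i with rfl | hi0
    · exact h0.ne' (hcon 0 (by omega))
    · apply hmin i hi
      have h1 : LexLE (reflect a) (shift^[i] a) := (ha i).1
      have h2 := h1.shift_of_agree (m := n + 1 - i) fun t ht => by
        rw [shift_iterate_apply, hcon t (by omega), reflect_apply]
      rw [shift_iterate_add, show i + (n + 1 - i) = n + 1 by omega, hq] at h2
      rw [← reflect_shift_iterate, lexLE_reflect] at h2
      have h3 : a = shift^[n + 1 - i] a := h2.antisymm (ha _).2
      have h4 : shift^[i] (shift^[n + 1 - i] a) = reflect a := by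
        rw [shift_iterate_add, Nat.sub_add_cancel hi.le, hq]
      rwa [← h3] at h4
  have hpos := hD.pos ha
  have hc : lowered a n ∈ seqV M := by
    refine lowered_mem_seqV ha h0 hD ?_
    by_contra! hcon
    obtain rfl : n = 0 := by omega
    have h1 : 2 * (a 0 : ℕ) = M + 1 := by
      rw [Fin.lt_def, Fin.val_rev] at h0
      omega
    have h2 := hper 0
    rw [show 0 + 1 + 0 = 1 by rfl, hB h1] at h2
    exact h0.ne' h2
  have hred := (isIrreducibleSeq_iff.1 hirr).2 n hpos hc
  refine absurd hred.le (not_lexLE.2 ?_)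
  refine lexLT_iff.2 ⟨n + 1 + n, fun i hi => ?_, ?_⟩
  · by_cases h : i < n + 1
    · rw [splice_of_lt h]
    · obtain ⟨s, rfl⟩ := Nat.exists_eq_add_of_le (not_lt.1 h)
      rw [splice_add, hper, reflect_apply, lowered_of_lt a (by omega)]
  · rw [splice_add, hper, reflect_apply, Fin.rev_lt_rev, Fin.lt_def, lowered_last]
    have h1 : 0 < (a n : ℕ) := hpos
    omega

/-! ### Mixing for irreducible sequences -/

/-- If `a` is irreducible and the first `N` symbols of `x ∈ box a` end with a prefix of `a` that is
the longest suffix which is a prefix of `a` or of its reflection, they can be extended to a word to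
which `openBox a` can be attached. -/
theorem exists_extension_of_suffix {a x : Seqs M} (hirr : IsIrreducibleSeq a)
    (h0 : (a 0).rev < a 0) (hB : 2 * (a 0 : ℕ) = M + 1 → a 1 = a 0) (hx : x ∈ box a) {N i : ℕ}
    (hiN : i ≤ N) (hi : ∀ t, i + t < N → x (i + t) = a t)
    (hmin : ∀ j < i, (∃ t, j + t < N ∧ x (j + t) ≠ a t) ∧
      ∃ t, j + t < N ∧ x (j + t) ≠ (a t).rev) :
    ∃ (e : Seqs M) (l : ℕ), N ≤ l ∧ (∀ i < N, e i = x i) ∧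
      ∀ z ∈ openBox a, splice l e z ∈ box a := by
  have ha := hirr.1
  -- The matched prefix has length N - i ≤ n, so the lowered symbol at index n lies beyond the first
  -- N symbols of x.
  obtain ⟨n, hn, hD⟩ := exists_noReflectedSuffix_of_ne ha
    (shift_iterate_ne_reflect hirr h0 hB) (N - i)
  obtain ⟨e, l, he⟩ := exists_continuation hirr h0 hB n hD
  have hag : ∀ ζ : Seqs M, ∀ k < N, splice i x (splice (n + 1) (lowered a n) ζ) k = x k := by
    intro ζ k hk
    by_cases hki : k < i
    · rw [splice_of_lt hki]
    · obtain ⟨t, rfl⟩ := Nat.exists_eq_add_of_le (not_lt.1 hki)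
      rw [splice_add, splice_of_lt (by omega), lowered_of_lt a (by omega), hi t hk]
  refine ⟨splice i x (splice (n + 1) (lowered a n) e), i + (n + 1 + l), by omega, hag e,
    fun z hz => ?_⟩
  rw [← splice_splice, ← splice_splice]
  refine splice_mem_box (he z hz).2 fun j hj => ?_
  rw [← shift_iterate_splice hj.le]
  have hag' : ∀ k < N - j, shift^[j] (splice i x (splice (n + 1) (lowered a n) (splice l e z))) k =
      shift^[j] x k := fun k hk => by
    rw [shift_iterate_apply, shift_iterate_apply, hag _ _ (by omega)]
  obtain ⟨⟨t, ht, h1⟩, ⟨s, hs, h2⟩⟩ := hmin j hj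
  constructor
  · rcases (hx j).1.agree_or_prefixLT (N - j) with h | h
    · refine absurd ?_ h2
      rw [← shift_iterate_apply _ x, ← h s (by omega), reflect_apply]
    · exact (PrefixLT.lexLT (h.congr_right hag')).le
  · rcases (hx j).2.agree_or_prefixLT (N - j) with h | h
    · refine absurd ?_ h1
      rw [← shift_iterate_apply _ x, h t (by omega)]
    · exact (PrefixLT.lexLT (h.congr_left hag')).le

/-- A one-letter sequence. -/
def letter (c : ℕ) : Seqs M := fun _ => Fin.ofNat (M + 1) c

theorem letter_val {c : ℕ} (h : c ≤ M) (i : ℕ) : ((letter c : Seqs M) i : ℕ) = c := by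
  simp [letter, Nat.mod_eq_of_lt (Nat.lt_succ_of_le h)]

theorem splice_letter_succ (n c : ℕ) (z : Seqs M) :
    splice (n + 1) (letter c) z = splice 1 (letter c) (splice n (letter c) z) := by
  rw [splice_splice, add_comm]
  congr 1
  funext i
  by_cases hi : i < 1 <;> simp [splice, hi, letter]

theorem splice_letter_mem_box {a z : Seqs M} {c : ℕ} (hz : z ∈ box a)
    (h : LexLE (reflect a) (splice 1 (letter c) z) ∧ LexLE (splice 1 (letter c) z) a) :
    splice 1 (letter c) z ∈ box a := by
  refine splice_mem_box hz fun n hn => ?_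
  obtain rfl : n = 0 := by omega
  exact h

/-- A symbol strictly between the least and the largest one decides both bounds at once. -/
theorem splice_letter_mem_box_of_lt {a z : Seqs M} {c : ℕ} (hc : c ≤ M) (hz : z ∈ box a)
    (h1 : M < (a 0 : ℕ) + c) (h2 : c < a 0) : splice 1 (letter c) z ∈ box a := by
  refine splice_letter_mem_box hz ⟨LexLT.le (lexLT_of_zero ?_), LexLT.le (lexLT_of_zero ?_)⟩
  · rw [splice_of_lt one_pos, reflect_apply, Fin.lt_def, letter_val hc, Fin.val_rev]; omega
  · rw [splice_of_lt one_pos, Fin.lt_def, letter_val hc]; exact h2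

/-- Switches sides: a word to which the reflection of `openBox a` can be attached accepts `openBox
a` itself after one more letter. -/
theorem exists_letter_reflect {a : Seqs M} (h0 : (a 0).rev < a 0)
    (hB : 2 * (a 0 : ℕ) = M + 1 → a 1 = a 0) :
    ∃ c, ∀ z ∈ openBox a, reflect (splice 1 (letter c) z) ∈ openBox a := by
  have h0' := h0
  rw [Fin.lt_def, Fin.val_rev] at h0'
  have ha0 := (a 0).2
  by_cases hcase : 2 * (a 0 : ℕ) = M + 1
  · refine ⟨M - a 0, fun z hz => ⟨box_reflect (splice_letter_mem_box hz.1 ⟨?_, ?_⟩), ?_⟩⟩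
    · refine LexLT.le (lexLT_of_one ?_ ?_)
      · rw [splice_of_lt one_pos, reflect_apply, Fin.ext_iff, letter_val (by omega), Fin.val_rev]
        omega
      · rw [splice_of_le le_rfl, reflect_apply, hB hcase]
        exact hz.2
    · refine LexLT.le (lexLT_of_zero ?_)
      rw [splice_of_lt one_pos, Fin.lt_def, letter_val (by omega)]
      omega
    · rw [reflect_apply, splice_of_lt one_pos, Fin.rev_lt_rev, Fin.lt_def, letter_val (by omega)]
      omega
  · refine ⟨M - a 0 + 1, fun z hz => ⟨box_reflect (splice_letter_mem_box_of_lt (by omega) hz.1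
      (by omega) (by omega)), ?_⟩⟩
    rw [reflect_apply, splice_of_lt one_pos, Fin.rev_lt_rev, Fin.lt_def, letter_val (by omega)]
    omega

theorem exists_extension {a x : Seqs M} (hirr : IsIrreducibleSeq a)
    (h0 : (a 0).rev < a 0) (hB : 2 * (a 0 : ℕ) = M + 1 → a 1 = a 0) (hx : x ∈ box a) (N : ℕ) :
    ∃ (e : Seqs M) (l : ℕ), N ≤ l ∧ (∀ i < N, e i = x i) ∧
      ∀ z ∈ openBox a, splice l e z ∈ box a := by
  classical
  -- The longest suffix of the given word matching a prefix of `a` or of its reflection; i = N is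
  -- the empty suffix. The bounds at earlier shifts are already strict within the word.
  have hex : ∃ i, i ≤ N ∧ ((∀ t, i + t < N → x (i + t) = a t) ∨
      ∀ t, i + t < N → x (i + t) = (a t).rev) :=
    ⟨N, le_rfl, Or.inl fun t ht => by omega⟩
  obtain ⟨hiN, hi⟩ := Nat.find_spec hex
  have hmin := fun k (hk : k < Nat.find hex) => Nat.find_min hex hk
  set i := Nat.find hex
  push Not at hmin
  rcases hi with hi | hi
  · exact exists_extension_of_suffix hirr h0 hB hx hiN hi fun j hj => hmin j hj (by omega)
  · obtain ⟨e, l, h1, h2, h3⟩ := exists_extension_of_suffix hirr h0 hB (box_reflect hx) hiN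
      (fun t ht => by rw [reflect_apply, hi t ht, Fin.rev_rev]) fun j hj => by
        obtain ⟨⟨t, ht, h4⟩, ⟨s, hs, h5⟩⟩ := hmin j hj (by omega)
        refine ⟨⟨s, hs, fun h => h5 ?_⟩, ⟨t, ht, fun h => h4 ?_⟩⟩
        · rw [← h, reflect_apply, Fin.rev_rev]
        · rwa [reflect_apply, Fin.rev_inj] at h
    obtain ⟨c, hc⟩ := exists_letter_reflect h0 hB
    refine ⟨splice l (reflect e) (letter c), l + 1, by omega, fun k hk => ?_, fun z hz => ?_⟩
    · rw [splice_of_lt (by omega), reflect_apply, h2 k hk, reflect_apply, Fin.rev_rev]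
    · rw [← splice_splice]
      have := box_reflect (h3 _ (hc z hz))
      rwa [reflect_splice, reflect_reflect] at this

/-! ### The transitive sequence -/

theorem transitiveSeq_val (hM : 1 ≤ M) (n : ℕ) : (transitiveSeq M n : ℕ) =
    if n = 0 then M / 2 + 1 else if Even M then M / 2 else if Odd n then M / 2 + 1 else M / 2 := by
  unfold transitiveSeq
  rw [Fin.val_ofNat, Nat.mod_eq_of_lt]
  split_ifs <;> omega

theorem transitiveSeq_zero (hM : 1 ≤ M) : (transitiveSeq M 0 : ℕ) = M / 2 + 1 := by
  simp [transitiveSeq_val hM]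

theorem transitiveSeq_one_of_odd (hM : Odd M) : (transitiveSeq M 1 : ℕ) = M / 2 + 1 := by
  have h1 : 1 ≤ M := hM.pos
  simp [transitiveSeq_val h1, Nat.not_even_iff_odd.2 hM]

/-- The sequence `((k + 1) k)^∞` for `M = 2k + 1`. -/
def alternating (M : ℕ) : Seqs M := fun n => Fin.ofNat (M + 1) (if Even n then M / 2 + 1 else M / 2)

theorem alternating_val (hM : 1 ≤ M) (n : ℕ) :
    (alternating M n : ℕ) = if Even n then M / 2 + 1 else M / 2 := by
  unfold alternating
  rw [Fin.val_ofNat, Nat.mod_eq_of_lt]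
  split_ifs <;> omega

theorem transitiveSeq_succ_of_odd (hM : Odd M) (n : ℕ) :
    transitiveSeq M (n + 1) = alternating M n := by
  have h1 : 1 ≤ M := hM.pos
  apply Fin.ext
  rw [transitiveSeq_val h1, alternating_val h1]
  simp [Nat.not_even_iff_odd.2 hM, Nat.odd_add_one]

theorem reflect_alternating (hM : Odd M) : reflect (alternating M) = shift (alternating M) := by
  have h1 : 1 ≤ M := hM.pos
  funext i
  apply Fin.ext
  rw [reflect_apply, Fin.val_rev, shift, alternating_val h1, alternating_val h1]
  obtain ⟨k, rfl⟩ := hM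
  simp only [Nat.even_add_one]
  split_ifs <;> omega

theorem shift_iterate_two_mul_alternating (s : ℕ) :
    shift^[2 * s] (alternating M) = alternating M := by
  funext i
  rw [shift_iterate_apply, alternating, alternating]
  simp [Nat.even_add]

/-- The lower bounds that follow from `T ≺ a` for odd `M`. -/
theorem le_of_transitiveSeq_lt (hM : 1 ≤ M) {a : Seqs M} (h : LexLT (transitiveSeq M) a) :
    M / 2 + 1 ≤ (a 0 : ℕ) := by
  have := h.le.apply_zero
  rwa [Fin.le_def, transitiveSeq_zero hM] at this

theorem le_one_of_transitiveSeq_lt (hM : Odd M) {a : Seqs M} (h : LexLT (transitiveSeq M) a)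
    (h0 : (a 0 : ℕ) = M / 2 + 1) : M / 2 + 1 ≤ (a 1 : ℕ) := by
  have := h.le.apply_one (Fin.ext (by rw [transitiveSeq_zero hM.pos, h0]))
  rwa [Fin.le_def, transitiveSeq_one_of_odd hM] at this

/-- Blocks (k+1)k can be put in front since `a` starts with a symbol above k+1 or with (k+1)(k+1).
In the second case `reflect a` starts with kk, and the larger first symbol of z protects the letter
k before it. -/
theorem splice_alternating_mem_box (hM : Odd M) {a z : Seqs M} (h : LexLT (transitiveSeq M) a)
    (hz : z ∈ box a) (hz0 : M / 2 + 1 ≤ (z 0 : ℕ)) (s : ℕ) :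
    splice (2 * s) (alternating M) z ∈ box a ∧
      M / 2 + 1 ≤ (splice (2 * s) (alternating M) z 0 : ℕ) := by
  have h1 : 1 ≤ M := hM.pos
  have hMk : M = 2 * (M / 2) + 1 := (Nat.two_mul_div_two_add_one_of_odd hM).symm
  induction s with
  | zero => simpa using ⟨hz, hz0⟩
  | succ s ih =>
    have hstep : splice (2 * (s + 1)) (alternating M) z =
        splice 2 (alternating M) (splice (2 * s) (alternating M) z) := by
      rw [splice_splice, show 2 * (s + 1) = 2 + 2 * s by ring]
      funext i
      by_cases hi : i < 2 + 2 * s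
      · rw [splice_of_lt hi, splice_of_lt hi]
        by_cases hi' : i < 2
        · rw [splice_of_lt hi']
        · obtain ⟨t, rfl⟩ := Nat.exists_eq_add_of_le (not_lt.1 hi')
          rw [splice_add, ← shift_iterate_apply _ (alternating M),
            shift_iterate_two_mul_alternating 1]
      · rw [splice_of_le (not_lt.1 hi), splice_of_le (not_lt.1 hi)]
    rw [hstep]
    set y := splice (2 * s) (alternating M) z
    have e0 : (alternating M 0 : ℕ) = M / 2 + 1 := by simp [alternating_val h1]
    have e1 : (alternating M 1 : ℕ) = M / 2 := by simp [alternating_val h1]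
    have ha0 := le_of_transitiveSeq_lt h1 h
    refine ⟨splice_mem_box ih.1 fun n hn => ?_, by rw [splice_of_lt (by omega), e0]⟩
    have hlow : ∀ w : Seqs M, M / 2 + 1 ≤ (w 0 : ℕ) → LexLE (reflect a) w := fun w hw =>
      LexLT.le (lexLT_of_zero (by rw [reflect_apply, Fin.lt_def, Fin.val_rev]; omega))
    rcases (show n = 0 ∨ n = 1 by omega) with rfl | rfl
    · simp only [Nat.sub_zero, Function.iterate_zero, id_eq]
      refine ⟨hlow _ (by rw [splice_of_lt (by omega), e0]), ?_⟩
      rcases (show M / 2 + 1 = (a 0 : ℕ) ∨ M / 2 + 1 < (a 0 : ℕ) by omega) with h2 | h2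
      · have ha1 := le_one_of_transitiveSeq_lt hM h h2.symm
        refine LexLT.le (lexLT_of_one (Fin.ext ?_) ?_)
        · rw [splice_of_lt (by omega), e0, h2]
        · rw [splice_of_lt (by omega), Fin.lt_def, e1]; omega
      · refine LexLT.le (lexLT_of_zero ?_)
        rw [splice_of_lt (by omega), Fin.lt_def, e0]; exact h2
    · constructor
      · rcases (show M / 2 + 1 = (a 0 : ℕ) ∨ M / 2 + 1 < (a 0 : ℕ) by omega) with h2 | h2
        · have ha1 := le_one_of_transitiveSeq_lt hM h h2.symm
          refine LexLT.le (lexLT_of_one (Fin.ext ?_) ?_)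
          · rw [splice_of_lt (by omega), shift_iterate_apply, e1, reflect_apply, Fin.val_rev]
            omega
          · rw [splice_of_le (by omega), Fin.lt_def, reflect_apply, Fin.val_rev]
            have := ih.2
            simp only [Nat.add_one_sub_one, Nat.sub_self]
            omega
        · refine LexLT.le (lexLT_of_zero ?_)
          rw [splice_of_lt (by omega), shift_iterate_apply, Fin.lt_def, e1, reflect_apply,
            Fin.val_rev]
          omega
      · refine LexLT.le (lexLT_of_zero ?_)
        rw [splice_of_lt (by omega), shift_iterate_apply, Fin.lt_def, e1]; omega

/-- Supplies the odd lengths: once the prefix of T passes the index where T drops below `a`, the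
tail no longer matters for the upper bound. -/
theorem exists_splice_transitiveSeq_mem_box (hM : Odd M) {a : Seqs M}
    (h : LexLT (transitiveSeq M) a) : ∃ s₀, ∀ s, s₀ ≤ s → ∀ z ∈ box a, M / 2 + 1 ≤ (z 0 : ℕ) →
      splice (2 * s + 1) (transitiveSeq M) z ∈ box a := by
  have h1 : 1 ≤ M := hM.pos
  have hMk : M = 2 * (M / 2) + 1 := (Nat.two_mul_div_two_add_one_of_odd hM).symm
  obtain ⟨p, hp1, hp2⟩ := lexLT_iff.1 h
  refine ⟨p, fun s hs z hz hz0 => ?_⟩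
  have hstep : splice (2 * s + 1) (transitiveSeq M) z =
      splice 1 (transitiveSeq M) (splice (2 * s) (alternating M) z) := by
    rw [splice_splice, add_comm]
    funext i
    by_cases hi : i < 1 + 2 * s
    · rw [splice_of_lt hi, splice_of_lt hi]
      by_cases hi' : i < 1
      · rw [splice_of_lt hi']
      · obtain ⟨t, rfl⟩ := Nat.exists_eq_add_of_le (not_lt.1 hi')
        rw [splice_add, Nat.add_comm 1 t, transitiveSeq_succ_of_odd hM]
    · rw [splice_of_le (not_lt.1 hi), splice_of_le (not_lt.1 hi)]
  have hle : LexLT (splice (2 * s + 1) (transitiveSeq M) z) a :=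
    lexLT_iff.2 ⟨p, fun i hi => by rw [splice_of_lt (by omega), hp1 i hi],
      by rw [splice_of_lt (by omega)]; exact hp2⟩
  rw [hstep] at hle ⊢
  refine splice_mem_box (splice_alternating_mem_box hM h hz hz0 s).1 fun n hn => ?_
  obtain rfl : n = 0 := by omega
  refine ⟨LexLT.le (lexLT_of_zero ?_), hle.le⟩
  have := le_of_transitiveSeq_lt h1 h
  rw [splice_of_lt (by omega), reflect_apply, Fin.lt_def, Fin.val_rev]
  simp only [Function.iterate_zero, id_eq, transitiveSeq_zero h1]
  omega

/-! ### Mixing of the box of an irreducible sequence -/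

theorem isMixingSubshift_box_of_irreducible {a : Seqs M} (hirr : IsIrreducibleSeq a)
    (h0 : (a 0).rev < a 0) (hB : 2 * (a 0 : ℕ) = M + 1 → LexLT (transitiveSeq M) a) :
    IsMixingSubshift (box a) := by
  have ha : a ∈ box a := hirr.1
  have h0' := h0
  rw [Fin.lt_def, Fin.val_rev] at h0'
  have ha0 := (a 0).2
  have hodd : 2 * (a 0 : ℕ) = M + 1 → Odd M := fun h => ⟨(a 0 : ℕ) - 1, by omega⟩
  have hB1 : 2 * (a 0 : ℕ) = M + 1 → a 1 = a 0 := fun h => by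
    have h1 := le_one_of_transitiveSeq_lt (hodd h) (hB h) (by omega)
    have h2 := box_apply_le ha 1
    rw [Fin.le_def] at h2
    exact Fin.ext (by omega)
  refine isMixingSubshift_of_connecting (Q := openBox a) (isSubshift_box ⟨a, ha⟩)
    (fun x hx N => exists_extension hirr h0 hB1 hx N) ?_ ?_
  all_goals by_cases hcase : 2 * (a 0 : ℕ) = M + 1
  · intro z hz
    by_cases hz0 : (a 0).rev < z 0
    · exact ⟨z, 0, by rw [splice_zero]; exact ⟨hz, hz0⟩⟩
    · have hz1 : z 0 = (a 0).rev := le_antisymm (not_lt.1 hz0) (le_box_apply hz 0)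
      refine ⟨letter (a 0), 1, splice_letter_mem_box hz ⟨?_, ?_⟩, ?_⟩
      · refine LexLT.le (lexLT_of_zero ?_)
        rw [splice_of_lt one_pos, reflect_apply, Fin.lt_def, letter_val (by omega), Fin.val_rev]
        omega
      · refine LexLT.le (lexLT_of_one ?_ ?_)
        · rw [splice_of_lt one_pos, Fin.ext_iff, letter_val (by omega)]
        · rw [splice_of_le le_rfl, hB1 hcase, Nat.sub_self, hz1]; exact h0
      · rw [splice_of_lt one_pos, Fin.lt_def, letter_val (by omega)]
        exact h0
  · intro z hz
    refine ⟨letter ((a 0 : ℕ) - 1), 1, splice_letter_mem_box_of_lt (by omega) hz (by omega)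
      (by omega), ?_⟩
    rw [splice_of_lt one_pos, Fin.lt_def, letter_val (by omega), Fin.val_rev]
    omega
  · have hiff : ∀ z : Seqs M, (a 0).rev < z 0 ↔ M / 2 + 1 ≤ (z 0 : ℕ) := fun z => by
      rw [Fin.lt_def, Fin.val_rev]; omega
    -- Fillers: (k+1)k blocks for even length, a prefix of T for odd length.
    obtain ⟨s₀, hs₀⟩ := exists_splice_transitiveSeq_mem_box (hodd hcase) (hB hcase)
    refine ⟨2 * s₀ + 1, fun n hn => ?_⟩
    rcases Nat.even_or_odd' n with ⟨s, rfl | rfl⟩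
    · refine ⟨alternating M, fun z hz => ?_⟩
      have := splice_alternating_mem_box (hodd hcase) (hB hcase) hz.1 ((hiff z).1 hz.2) s
      exact ⟨this.1, (hiff _).2 this.2⟩
    · refine ⟨transitiveSeq M, fun z hz => ⟨hs₀ s (by omega) z hz.1 ((hiff z).1 hz.2), ?_⟩⟩
      rw [hiff, splice_of_lt (by omega), transitiveSeq_zero (hodd hcase).pos]
  · refine ⟨0, fun n hn => ⟨letter ((a 0 : ℕ) - 1), fun z hz => ?_⟩⟩
    clear hn
    induction n with
    | zero => simpa using hz
    | succ n ih =>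
      rw [splice_letter_succ]
      refine ⟨splice_letter_mem_box_of_lt (by omega) ih.1 (by omega) (by omega), ?_⟩
      rw [splice_of_lt one_pos, Fin.lt_def, letter_val (by omega), Fin.val_rev]
      omega

/-! ### Transitive boxes -/

theorem IsTransitiveSubshift.exists_connecting {X : Set (Seqs M)} (hX : IsTransitiveSubshift X)
    {x y : Seqs M} (hx : x ∈ X) (hy : y ∈ X) (N L : ℕ) :
    ∃ P ∈ X, ∃ p, N ≤ p ∧ (∀ i < N, P i = x i) ∧ ∀ i < L, P (p + i) = y i := by
  have hmem : ∀ z ∈ X, ∀ n, List.ofFn (fun i : Fin n => z i) ∈ language X := fun z hz n =>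
    Set.mem_iUnion.2 ⟨n, by simpa using prefix_mem_language hz 0 n⟩
  obtain ⟨w, -, hw⟩ := hX.2 _ (hmem x hx N) _ (hmem y hy L)
  obtain ⟨P, hP, hPw⟩ := (language_iff hX.1.2.2).1 hw
  simp only [List.length_append, List.length_ofFn] at hPw
  refine ⟨P, hP, N + w.length, by omega, fun i hi => ?_, fun i hi => ?_⟩
  · rw [← hPw i (by omega)]
    simp [hi]
  · rw [← hPw (N + w.length + i) (by omega), List.getElem_append_right (by simp)]
    simp

theorem alternating_mem_box (hM : Odd M) {a : Seqs M} (h : LexLE (alternating M) a) :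
    alternating M ∈ box a := by
  have hle : LexLE (reflect (alternating M)) (alternating M) := by
    refine LexLT.le (lexLT_of_zero ?_)
    obtain ⟨k, rfl⟩ := hM
    rw [reflect_apply, Fin.lt_def, Fin.val_rev, alternating_val (by omega)]
    simp; omega
  have hr := lexLE_reflect.2 h
  intro n
  rcases Nat.even_or_odd' n with ⟨s, rfl | rfl⟩
  · rw [shift_iterate_two_mul_alternating]
    exact ⟨hr.trans hle, h⟩
  · have : shift^[2 * s + 1] (alternating M) = reflect (alternating M) := by
      rw [← shift_iterate_add 1 (2 * s), shift_iterate_two_mul_alternating,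
        reflect_alternating hM]
      rfl
    rw [this]
    exact ⟨hr, hle.trans h⟩

theorem reflect_letter (hM : Even M) : reflect (letter (M / 2) : Seqs M) = letter (M / 2) := by
  obtain ⟨k, rfl⟩ := hM
  funext i
  apply Fin.ext
  rw [reflect_apply, Fin.val_rev, letter_val (by omega)]
  omega

theorem letter_mem_box (hM : Even M) {a : Seqs M} (h : LexLE (letter (M / 2)) a) :
    letter (M / 2) ∈ box a := by
  intro n
  have : shift^[n] (letter (M / 2) : Seqs M) = letter (M / 2) := by
    funext i; rw [shift_iterate_apply]; rfl
  rw [this]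
  refine ⟨?_, h⟩
  rw [← reflect_letter hM, lexLE_reflect]
  exact h

theorem half_le_apply_zero {a : Seqs M} (ha : a ∈ seqV M) : M ≤ 2 * (a 0 : ℕ) := by
  have := le_box_apply ha 0
  rw [Fin.le_def, Fin.val_rev] at this
  omega

/-- Only the symbols k and k+1 occur; the bound on `a 1` forbids (k+1)(k+1), and by reflection kk.
-/
theorem eq_alternating {a : Seqs M} (hM : Odd M) (ha : a ∈ seqV M) (h0 : (a 0 : ℕ) = M / 2 + 1)
    (h1 : (a 1 : ℕ) ≤ M / 2) : a = alternating M := by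
  have hM1 : 1 ≤ M := hM.pos
  have hMk : M = 2 * (M / 2) + 1 := (Nat.two_mul_div_two_add_one_of_odd hM).symm
  have hup : ∀ n, (a n : ℕ) ≤ M / 2 + 1 := fun n => by
    have := box_apply_le ha n
    rw [Fin.le_def] at this; omega
  have hlo : ∀ n, M / 2 ≤ (a n : ℕ) := fun n => by
    have := le_box_apply ha n
    rw [Fin.le_def, Fin.val_rev] at this; omega
  have hup1 : ∀ n, (a n : ℕ) = M / 2 + 1 → (a (n + 1) : ℕ) = M / 2 := fun n hn => by
    have := (ha n).2.apply_one (by rw [shift_iterate_apply]; exact Fin.ext (by simp [hn, h0]))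
    rw [shift_iterate_apply, Fin.le_def] at this
    have := hlo (n + 1)
    omega
  have hlo1 : ∀ n, (a n : ℕ) = M / 2 → (a (n + 1) : ℕ) = M / 2 + 1 := fun n hn => by
    have := (ha n).1.apply_one (by
      rw [shift_iterate_apply, reflect_apply]
      exact Fin.ext (by rw [Fin.val_rev, h0, add_zero, hn]; omega))
    rw [shift_iterate_apply, Fin.le_def, reflect_apply, Fin.val_rev] at this
    have := hup (n + 1)
    omega
  funext n
  apply Fin.ext
  induction n with
  | zero => rw [h0, alternating_val hM1]; simp
  | succ n ih =>
    rw [alternating_val hM1] at ih ⊢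
    simp only [Nat.even_add_one, ite_not]
    split_ifs at ih ⊢
    · exact hup1 n ih
    · exact hlo1 n ih

/-- Thus irreducibility at the prefix (k+1)(k+1) is precisely the statement T ≺ a. -/
theorem splice_lowered_one_eq (hO : Odd M) {a : Seqs M} (h0 : (a 0 : ℕ) = M / 2 + 1)
    (h1 : (a 1 : ℕ) = M / 2 + 1) :
    splice (1 + 1) a (reflect (lowered a 1)) = transitiveSeq M := by
  have hMk : M = 2 * (M / 2) + 1 := (Nat.two_mul_div_two_add_one_of_odd hO).symm
  have hlast := lowered_last a 1
  funext i
  apply Fin.ext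
  rw [transitiveSeq_val hO.pos, if_neg (Nat.not_even_iff_odd.2 hO)]
  rcases (show i = 0 ∨ i = 1 ∨ 2 ≤ i by omega) with rfl | rfl | hi
  · rw [splice_of_lt (by omega), if_pos rfl, h0]
  · rw [splice_of_lt (by omega), if_neg one_ne_zero, if_pos odd_one, h1]
  · rw [splice_of_le (by omega), if_neg (by omega), reflect_apply, Fin.val_rev]
    rcases Nat.even_or_odd' i with ⟨s, rfl | rfl⟩
    · rw [← lowered_mod, show (2 * s - (1 + 1)) % (1 + 1) = 0 by omega,
        lowered_of_lt a (by omega), if_neg (by simp)]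
      omega
    · rw [← lowered_mod, show (2 * s + 1 - (1 + 1)) % (1 + 1) = 1 by omega,
        if_pos (by simp)]
      omega

/-- The first symbols of the lowered word at which irreducibility fails. -/
theorem lowered_bound (hM : 1 ≤ M) {a : Seqs M} (ha : a ∈ seqV M) (hT : LexLT (transitiveSeq M) a)
    {n : ℕ} (hc : lowered a n ∈ seqV M)
    (hle : LexLE a (splice (n + 1) a (reflect (lowered a n)))) :
    (Even M → M / 2 + 1 ≤ (lowered a n 0 : ℕ)) ∧
      (Odd M → M / 2 + 2 ≤ (lowered a n 0 : ℕ) ∨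
        (lowered a n 0 : ℕ) = M / 2 + 1 ∧ M / 2 + 1 ≤ (lowered a n 1 : ℕ)) := by
  have ha0 := le_of_transitiveSeq_lt hM hT
  have hc0 := half_le_apply_zero hc
  have hlast := lowered_last a n
  have hconst : ∀ i, lowered a 0 i = lowered a 0 0 := fun i => by
    rw [← lowered_mod]; simp [Nat.mod_one]
  constructor
  · intro hE
    have hMk : M = 2 * (M / 2) := (Nat.two_mul_div_two_of_even hE).symm
    rcases Nat.eq_zero_or_pos n with rfl | hn
    · by_contra hlt
      refine absurd hle (not_lexLE.2 ?_)
      have : splice (0 + 1) a (reflect (lowered a 0)) = transitiveSeq M := by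
        funext i
        apply Fin.ext
        rw [transitiveSeq_val hM]
        by_cases hi : i = 0
        · subst hi
          rw [splice_of_lt (by omega), if_pos rfl]; omega
        · rw [splice_of_le (by omega), if_neg hi, if_pos hE, reflect_apply, Fin.val_rev, hconst]
          omega
      rw [this]; exact hT
    · rw [lowered_of_lt a hn]; exact ha0
  · intro hO
    have hMk : M = 2 * (M / 2) + 1 := (Nat.two_mul_div_two_add_one_of_odd hO).symm
    rcases (show n = 0 ∨ n = 1 ∨ 2 ≤ n by omega) with rfl | rfl | hn
    · rw [hconst 1]; omega
    · rw [lowered_of_lt a (by omega)]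
      by_contra! hlt
      have h0 : (a 0 : ℕ) = M / 2 + 1 := by omega
      have h1 := le_one_of_transitiveSeq_lt hO hT h0
      have h2 := box_apply_le ha 1
      rw [Fin.le_def] at h2
      refine absurd hle (not_lexLE.2 ?_)
      rw [splice_lowered_one_eq hO (by omega) (by omega)]; exact hT
    · rw [lowered_of_lt a (by omega), lowered_of_lt a (by omega)]
      rcases (show (a 0 : ℕ) = M / 2 + 1 ∨ M / 2 + 2 ≤ (a 0 : ℕ) by omega) with h | h
      · exact Or.inr ⟨h, le_one_of_transitiveSeq_lt hO hT h⟩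
      · exact Or.inl h

/-- If irreducibility fails at `n`, the sequences below the reflected raised periodic sequence are
invariant, up to reflection, under the shift by `n + 1`. -/
theorem block_invariant_aux {a y : Seqs M} {n : ℕ}
    (hle : LexLE a (splice (n + 1) a (reflect (lowered a n)))) (hy : y ∈ box a)
    (h : LexLE y (reflect (lowered a n))) :
    LexLE (shift^[n + 1] y) (reflect (lowered a n)) ∨ LexLE (lowered a n) (shift^[n + 1] y) := by
  rcases h.agree_or_prefixLT (n + 1) with h1 | ⟨t, ht, h1, h2⟩
  · left
    have := h.shift_of_agree h1
    rwa [← reflect_shift_iterate, shift_iterate_lowered] at this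
  · right
    have htn : t = n := by
      by_contra hne
      refine absurd (le_box hy) (not_lexLE.2 (lexLT_iff.2 ⟨t, fun i hi => ?_, ?_⟩))
      · rw [h1 i hi, reflect_apply, reflect_apply, lowered_of_lt a (by omega)]
      · rwa [reflect_apply, ← lowered_of_lt a (show t < n by omega), ← reflect_apply]
    subst htn
    have h4 : ∀ s < t, reflect a s = y s := fun s hs => by
      rw [h1 s hs, reflect_apply, reflect_apply, lowered_of_lt a hs]
    have h5 : reflect a t = y t := by
      have h6 := lexLE_iff.1 (le_box hy) t h4
      rw [reflect_apply, Fin.lt_def, Fin.val_rev, lowered_last] at h2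
      rw [reflect_apply, Fin.le_def, Fin.val_rev] at h6
      rw [reflect_apply, Fin.ext_iff, Fin.val_rev]
      omega
    have h6 := (le_box hy).shift_of_agree (m := t + 1) fun s hs => by
      rcases (show s < t ∨ s = t by omega) with h | rfl
      · exact h4 s h
      · exact h5
    refine LexLE.trans ?_ h6
    have h7 := hle.shift_of_agree (m := t + 1) fun s hs => (splice_of_lt hs _ _).symm
    rw [shift_iterate_splice_self, ← lexLE_reflect, reflect_reflect, reflect_shift_iterate] at h7
    exact h7

theorem block_invariant {a y : Seqs M} {n : ℕ}
    (hle : LexLE a (splice (n + 1) a (reflect (lowered a n)))) (hy : y ∈ box a)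
    (h : LexLE y (reflect (lowered a n)) ∨ LexLE (lowered a n) y) :
    LexLE (shift^[n + 1] y) (reflect (lowered a n)) ∨ LexLE (lowered a n) (shift^[n + 1] y) := by
  rcases h with h | h
  · exact block_invariant_aux hle hy h
  · have := block_invariant_aux hle (box_reflect hy) (lexLE_reflect.2 h)
    rw [← reflect_shift_iterate, lexLE_reflect] at this
    rcases this with h | h
    · exact Or.inr h
    · refine Or.inl ?_
      rw [← lexLE_reflect, reflect_reflect]
      exact h

/-- Every sequence that is larger than the transitive sequence and has a transitive box is
irreducible. -/
theorem isIrreducibleSeq_of_transitive (hM : 1 ≤ M) {a : Seqs M} (ha : a ∈ seqV M)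
    (hT : LexLT (transitiveSeq M) a) (htr : IsTransitiveSubshift (box a)) :
    IsIrreducibleSeq a := by
  rw [isIrreducibleSeq_iff]
  refine ⟨ha, fun n _ hc => ?_⟩
  by_contra hcon
  have hle := not_lexLT.1 hcon
  have hb := lowered_bound hM ha hT hc hle
  have ha0 := le_of_transitiveSeq_lt hM hT
  -- The witness is k^∞ or ((k+1)k)^∞. With c the lowered sequence, none of its shifts is ≼ the
  -- reflection of c or ≽ c, and two symbols suffice to see it.
  obtain ⟨h, hmem, hh⟩ : ∃ h ∈ box a, ∀ i, ∀ y : Seqs M, y 0 = h i → y 1 = h (i + 1) →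
      ¬ (LexLE y (reflect (lowered a n)) ∨ LexLE (lowered a n) y) := by
    rcases Nat.even_or_odd M with hE | hO
    · have hMk : M = 2 * (M / 2) := (Nat.two_mul_div_two_of_even hE).symm
      have hb1 := hb.1 hE
      refine ⟨letter (M / 2), letter_mem_box hE (LexLT.le (lexLT_of_zero ?_)), ?_⟩
      · rw [Fin.lt_def, letter_val (by omega)]; omega
      · rintro i y h0 - (h | h)
        · have := h.apply_zero
          rw [h0, Fin.le_def, letter_val (by omega), reflect_apply, Fin.val_rev] at this
          omega
        · have := h.apply_zero
          rw [h0, Fin.le_def, letter_val (by omega)] at this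
          omega
    · have hMk : M = 2 * (M / 2) + 1 := (Nat.two_mul_div_two_add_one_of_odd hO).symm
      have hb1 := hb.2 hO
      refine ⟨alternating M, alternating_mem_box hO ?_, ?_⟩
      · refine LexLE.trans (LexLT.le (lexLT_of_one (Fin.ext ?_) ?_)) hT.le
        · rw [alternating_val hM, transitiveSeq_zero hM]; simp
        · rw [Fin.lt_def, alternating_val hM, transitiveSeq_one_of_odd hO]; simp
      · have key : ∀ y : Seqs M, (y 0 : ℕ) ≤ M / 2 + 1 → (y 0 : ℕ) + y 1 = M →
            ¬ LexLE (lowered a n) y := fun y h0 h1 h => by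
          have h2 := h.apply_zero
          rw [Fin.le_def] at h2
          have h3 : lowered a n 0 = y 0 := Fin.ext (by omega)
          have h4 := h.apply_one h3
          rw [Fin.le_def] at h4
          omega
        rintro i y h0 h1
        have h0' := congrArg Fin.val h0
        have h1' := congrArg Fin.val h1
        rw [alternating_val hM] at h0' h1'
        simp only [Nat.even_add_one, ite_not] at h1'
        rintro (h | h)
        · rw [← lexLE_reflect, reflect_reflect] at h
          refine key _ ?_ ?_ h
          · rw [reflect_apply, Fin.val_rev]; split_ifs at h0' h1' <;> omega
          · rw [reflect_apply, Fin.val_rev, reflect_apply, Fin.val_rev]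
            split_ifs at h0' h1' <;> omega
        · refine key y ?_ ?_ h
          · split_ifs at h0' h1' <;> omega
          · split_ifs at h0' h1' <;> omega
  -- A window of n + 2 symbols of the witness contains a position divisible by n + 1 together with
  -- its successor. There the invariance of the two outer ranges is contradicted.
  obtain ⟨P, hP, p, hp, hPa, hPh⟩ := htr.exists_connecting (show a ∈ box a from ha) hmem (n + 1)
    (n + 2)
  have hinv : ∀ s, LexLE (shift^[(n + 1) * (s + 1)] P) (reflect (lowered a n)) ∨
      LexLE (lowered a n) (shift^[(n + 1) * (s + 1)] P) := fun s => by
    induction s with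
    | zero =>
      left
      have h1 := (box_le hP).shift_of_agree hPa
      have h2 := hle.shift_of_agree (m := n + 1) fun s hs => (splice_of_lt hs _ _).symm
      rw [shift_iterate_splice_self] at h2
      simpa using h1.trans h2
    | succ s ih =>
      have := block_invariant hle (box_shift_iterate hP _) ih
      rw [shift_iterate_add] at this
      rwa [show (n + 1) * (s + 1 + 1) = (n + 1) * (s + 1) + (n + 1) by ring]
  obtain ⟨s, d, hsd, hd⟩ : ∃ s d, (n + 1) * (s + 1) = p + d ∧ d ≤ n := by
    refine ⟨(p - 1) / (n + 1), (n + 1) * ((p - 1) / (n + 1) + 1) - p, ?_, ?_⟩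
    · have := Nat.lt_mul_div_succ (p - 1) (show 0 < n + 1 by omega)
      omega
    · have := Nat.mul_div_le (p - 1) (n + 1)
      rw [mul_add, mul_one]
      omega
  refine hh d _ ?_ ?_ (hinv s)
  · rw [shift_iterate_apply, hsd, add_zero, hPh d (by omega)]
  · rw [shift_iterate_apply, hsd, add_assoc, hPh (d + 1) (by omega)]

/-! ### Failure of transitivity below the transitive sequence -/

theorem exists_last_index {p : ℕ} {R : ℕ → Prop} (hp : 0 < p) (h : R 0) :
    ∃ i < p, R i ∧ ∀ j, i < j → j < p → ¬ R j := by
  induction p with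
  | zero => omega
  | succ p ih =>
    by_cases hR : R p
    · exact ⟨p, by omega, hR, fun j h1 h2 => by omega⟩
    · rcases Nat.eq_zero_or_pos p with rfl | hp0
      · exact absurd h hR
      · obtain ⟨i, h1, h2, h3⟩ := ih hp0
        refine ⟨i, by omega, h2, fun j h4 h5 => ?_⟩
        rcases (show j < p ∨ j = p by omega) with h6 | rfl
        · exact h3 j h4 h6
        · exact hR

/-- The first d + 1 symbols of T form a word larger than the corresponding prefix of `a`, so it is
forbidden. -/
theorem not_agree_transitiveSeq {a P : Seqs M} {d : ℕ} (hP : P ∈ box a)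
    (hd1 : ∀ i < d, a i = transitiveSeq M i) (hd2 : a d < transitiveSeq M d) (i : ℕ) :
    ¬ ∀ t ≤ d, P (i + t) = transitiveSeq M t := fun h => by
  have := lexLE_iff.1 (hP i).2 d fun t ht => by
    rw [shift_iterate_apply, h t ht.le, hd1 t ht]
  rw [shift_iterate_apply, h d le_rfl] at this
  exact absurd hd2 (not_lt.2 this)

theorem not_transitive_of_even (hM : 1 ≤ M) (hE : Even M) {a : Seqs M} (ha : a ∈ seqV M)
    (h0 : (a 0 : ℕ) = M / 2 + 1) (hT : LexLT a (transitiveSeq M)) :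
    ¬ IsTransitiveSubshift (box a) := by
  intro htr
  have hMk : M = 2 * (M / 2) := (Nat.two_mul_div_two_of_even hE).symm
  obtain ⟨d, hd1, hd2⟩ := lexLT_iff.1 hT
  have hk : (letter (M / 2) : Seqs M) ∈ box a := by
    refine letter_mem_box hE (LexLT.le (lexLT_of_zero ?_))
    rw [Fin.lt_def, letter_val (by omega)]; omega
  obtain ⟨P, hP, p, hp, hPa, hPh⟩ := htr.exists_connecting (show a ∈ box a from ha) hk 1 (d + 1)
  -- The last symbol other than k before the run of k's is k+1 or k-1; with d symbols k after it,
  -- this is a forbidden prefix of T or its reflection.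
  obtain ⟨i, hip, hi, hlast⟩ := exists_last_index (p := p) (R := fun i => (P i : ℕ) ≠ M / 2)
    (by omega) (by rw [hPa 0 one_pos]; omega)
  have hrun : ∀ t, 1 ≤ t → t ≤ d → (P (i + t) : ℕ) = M / 2 := fun t ht htd => by
    by_cases h : i + t < p
    · exact not_not.1 (hlast _ (by omega) h)
    · obtain ⟨s, hs⟩ := Nat.exists_eq_add_of_le (not_lt.1 h)
      rw [hs, hPh s (by omega), letter_val (by omega)]
  have key : ∀ P' ∈ box a, (P' i : ℕ) = M / 2 + 1 →
      ¬ ∀ t, 1 ≤ t → t ≤ d → (P' (i + t) : ℕ) = M / 2 := fun P' hP' hi' hrun' => by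
    refine not_agree_transitiveSeq hP' hd1 hd2 i fun t ht => Fin.ext ?_
    rw [transitiveSeq_val hM]
    split_ifs with h1
    · rw [h1, add_zero, hi']
    · exact hrun' t (by omega) ht
  have h1 := box_apply_le hP i
  have h2 := le_box_apply hP i
  rw [Fin.le_def, h0] at h1
  rw [Fin.le_def, Fin.val_rev, h0] at h2
  rcases (show (P i : ℕ) = M / 2 + 1 ∨ (P i : ℕ) + 1 = M / 2 by omega) with h3 | h3
  · exact key P hP h3 hrun
  · refine key _ (box_reflect hP) ?_ fun t ht htd => ?_
    · rw [reflect_apply, Fin.val_rev]; omega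
    · rw [reflect_apply, Fin.val_rev, hrun t ht htd]; omega

theorem not_transitive_of_odd (hO : Odd M) {a : Seqs M} (ha : a ∈ seqV M)
    (h0 : (a 0 : ℕ) = M / 2 + 1) (h1 : (a 1 : ℕ) = M / 2 + 1) (hT : LexLT a (transitiveSeq M)) :
    ¬ IsTransitiveSubshift (box a) := by
  intro htr
  have hM : 1 ≤ M := hO.pos
  have hMk : M = 2 * (M / 2) + 1 := (Nat.two_mul_div_two_add_one_of_odd hO).symm
  obtain ⟨d, hd1, hd2⟩ := lexLT_iff.1 hT
  have hk : alternating M ∈ box a := by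
    refine alternating_mem_box hO (LexLT.le (lexLT_of_one (Fin.ext ?_) ?_))
    · rw [alternating_val hM, h0]; simp
    · rw [Fin.lt_def, alternating_val hM, h1]; simp
  obtain ⟨P, hP, p, hp, hPa, hPh⟩ := htr.exists_connecting (show a ∈ box a from ha) hk 2 (d + 1)
  -- After the last pair of equal neighbours the symbols alternate long enough to give a forbidden
  -- prefix of T or its reflection.
  obtain ⟨i, hip, hi, hlast⟩ := exists_last_index (p := p) (R := fun i => P i = P (i + 1))
    (by omega) (by rw [hPa 0 two_pos, hPa 1 one_lt_two]; exact Fin.ext (by omega))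
  have hrange : ∀ P' ∈ box a, ∀ j, M / 2 ≤ (P' j : ℕ) ∧ (P' j : ℕ) ≤ M / 2 + 1 :=
    fun P' hP' j => by
      have h2 := box_apply_le hP' j
      have h3 := le_box_apply hP' j
      rw [Fin.le_def] at h2 h3
      rw [Fin.val_rev] at h3
      omega
  have hrun : ∀ t, 1 ≤ t → t < d → P (i + t) ≠ P (i + t + 1) := fun t ht htd => by
    by_cases h : i + t < p
    · exact hlast _ (by omega) h
    · obtain ⟨s, hs⟩ := Nat.exists_eq_add_of_le (not_lt.1 h)
      rw [hs, hPh s (by omega), add_assoc, hPh (s + 1) (by omega), Ne, Fin.ext_iff,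
        alternating_val hM, alternating_val hM]
      simp only [Nat.even_add_one, ite_not]
      split_ifs <;> omega
  have key : ∀ P' ∈ box a, (P' i : ℕ) = M / 2 + 1 → P' i = P' (i + 1) →
      ¬ ∀ t, 1 ≤ t → t < d → P' (i + t) ≠ P' (i + t + 1) := fun P' hP' h2 h3 hrun' => by
    refine not_agree_transitiveSeq hP' hd1 hd2 i fun t ht => Fin.ext ?_
    rcases Nat.eq_zero_or_pos t with rfl | ht0
    · rw [add_zero, h2, transitiveSeq_zero hM]
    · obtain ⟨s, rfl⟩ := Nat.exists_eq_add_of_le' ht0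
      rw [transitiveSeq_succ_of_odd hO, alternating_val hM]
      clear ht0
      induction s with
      | zero => rw [zero_add, ← h3, h2]; simp
      | succ s ih =>
        have h4 := ih (by omega)
        have h5 := hrun' (s + 1) (by omega) (by omega)
        have h6 := hrange P' hP' (i + (s + 1 + 1))
        rw [Ne, Fin.ext_iff, add_assoc i] at h5
        simp only [Nat.even_add_one, ite_not]
        simp only [Nat.succ_eq_add_one, zero_add] at h4 ⊢
        split_ifs at h4 ⊢ <;> omega
  rcases (show (P i : ℕ) = M / 2 + 1 ∨ (P i : ℕ) = M / 2 by
    have := hrange P hP i; omega) with h2 | h2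
  · exact key P hP h2 hi hrun
  · refine key _ (box_reflect hP) ?_ ?_ fun t ht htd => ?_
    · rw [reflect_apply, Fin.val_rev]; omega
    · rw [reflect_apply, reflect_apply, hi]
    · rw [reflect_apply, reflect_apply, Ne, Fin.rev_inj]
      exact hrun t ht htd

/-! ### The small boxes for even `M` -/

theorem isMixingSubshift_box_of_const (hE : Even M) {a : Seqs M} (ha : a ∈ seqV M)
    (h0 : (a 0 : ℕ) ≤ M / 2) : IsMixingSubshift (box a) := by
  have hMk : M = 2 * (M / 2) := (Nat.two_mul_div_two_of_even hE).symm
  have heq : ∀ x ∈ box a, x = letter (M / 2) := fun x hx => by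
    funext i
    have h1 := box_apply_le hx i
    have h2 := le_box_apply hx i
    rw [Fin.le_def] at h1 h2
    rw [Fin.val_rev] at h2
    apply Fin.ext
    rw [letter_val (by omega)]
    omega
  have hk : (letter (M / 2) : Seqs M) ∈ box a := heq a ha ▸ ha
  have hs : ∀ n, ∀ z ∈ box a, splice n (letter (M / 2)) z ∈ box a := fun n z hz => by
    rw [heq z hz]
    have : splice n (letter (M / 2)) (letter (M / 2)) = (letter (M / 2) : Seqs M) := by
      funext i; simp [splice, letter]
    rwa [this]
  refine isMixingSubshift_of_connecting (Q := box a) (isSubshift_box ⟨a, ha⟩)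
    (fun x hx N => ⟨x, N, le_rfl, fun _ _ => rfl, fun z hz => ?_⟩)
    (fun z hz => ⟨z, 0, by rwa [splice_zero]⟩) ⟨0, fun n _ => ⟨_, hs n⟩⟩
  rw [heq x hx]
  exact hs N z hz

/-- T = (k+1)k^∞ is not irreducible (lowering its first symbol gives k^∞, with equality in the
comparison), so gluing is done by hand: in this box the symbols k+1 and k-1 alternate, separated by
runs of k. -/
theorem isMixingSubshift_box_transitiveSeq (hM : 1 ≤ M) (hE : Even M)
    (hT : transitiveSeq M ∈ seqV M) : IsMixingSubshift (box (transitiveSeq M)) := by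
  classical
  have hMk : M = 2 * (M / 2) := (Nat.two_mul_div_two_of_even hE).symm
  have hT0 := transitiveSeq_zero hM
  have hTs : ∀ n, (transitiveSeq M (n + 1) : ℕ) = M / 2 := fun n => by
    rw [transitiveSeq_val hM, if_neg (by omega), if_pos hE]
  have hshift : ∀ m, 0 < m → shift^[m] (transitiveSeq M) = letter (M / 2) := fun m hm => by
    funext i
    obtain ⟨n, rfl⟩ := Nat.exists_eq_add_of_le' hm
    apply Fin.ext
    rw [shift_iterate_apply, add_right_comm, hTs, letter_val (by omega)]
  have hshift' : ∀ m, 0 < m → shift^[m] (reflect (transitiveSeq M)) = letter (M / 2) :=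
    fun m hm => by rw [← reflect_shift_iterate, hshift m hm, reflect_letter hE]
  have key : ∀ x ∈ box (transitiveSeq M), ∀ N,
      (∀ i < N, ∃ t, i + t < N ∧ x (i + t) ≠ transitiveSeq M t) →
      ∀ z ∈ box (transitiveSeq M), LexLE (letter (M / 2)) z →
      splice N x z ∈ box (transitiveSeq M) := fun x hx N hN z hz hzk => by
    refine splice_mem_box hz fun j hj => ⟨?_, ?_⟩
    · rcases (hx j).1.agree_or_prefixLT (N - j) with h | h
      · refine lexLE_of_agree (m := N - j) (fun t ht => by rw [splice_of_lt ht, h t ht]) ?_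
        rwa [shift_iterate_splice_self, hshift' _ (by omega)]
      · exact (PrefixLT.lexLT (h.congr_right fun i hi => splice_of_lt hi _ _)).le
    · rcases (hx j).2.agree_or_prefixLT (N - j) with h | h
      · obtain ⟨t, ht, hne⟩ := hN j hj
        refine absurd ?_ hne
        rw [← shift_iterate_apply _ x, h t (by omega)]
      · exact (PrefixLT.lexLT (h.congr_left fun i hi => splice_of_lt hi _ _)).le
  refine isMixingSubshift_of_connecting
    (Q := {z | z ∈ box (transitiveSeq M) ∧ LexLE (letter (M / 2)) z})
    (isSubshift_box ⟨_, hT⟩) (fun x hx N => ?_) (fun z hz => ?_) ⟨0, fun n hn => ?_⟩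
  · by_cases h1 : ∀ i < N, ∃ t, i + t < N ∧ x (i + t) ≠ transitiveSeq M t
    · exact ⟨x, N, le_rfl, fun _ _ => rfl, fun z hz => key x hx N h1 z hz.1 hz.2⟩
    -- A word cannot end both in a prefix of T and in a prefix of its reflection, since its last
    -- symbol other than k is unique. If it is k+1, inserting k-1 restores attachability.
    · have h2 : ∀ i < N, ∃ t, i + t < N ∧ reflect x (i + t) ≠ transitiveSeq M t := by
        by_contra! h2
        push Not at h1
        obtain ⟨i, hi, h3⟩ := h1
        obtain ⟨j, hj, h4⟩ := h2
        have h5 := h3 0 (by omega)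
        have h6 := h4 0 (by omega)
        rw [add_zero, Fin.ext_iff] at h5 h6
        rw [reflect_apply, Fin.val_rev] at h6
        rcases lt_trichotomy i j with h | rfl | h
        · obtain ⟨s, rfl⟩ := Nat.exists_eq_add_of_lt h
          have h7 := h3 (s + 1) (by omega)
          rw [← add_assoc, Fin.ext_iff, hTs] at h7
          omega
        · omega
        · obtain ⟨s, rfl⟩ := Nat.exists_eq_add_of_lt h
          have h7 := h4 (s + 1) (by omega)
          rw [← add_assoc, Fin.ext_iff, hTs, reflect_apply, Fin.val_rev] at h7
          omega
      refine ⟨splice N x (letter (M / 2 - 1)), N + 1, by omega, fun i hi => splice_of_lt hi _ _,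
        fun z hz => ?_⟩
      rw [← splice_splice]
      have hz' : splice 1 (letter (M / 2 - 1)) z ∈ box (transitiveSeq M) := by
        refine splice_letter_mem_box hz.1 ⟨lexLE_of_agree (m := 1) (fun i hi => ?_) ?_,
          LexLT.le (lexLT_of_zero ?_)⟩
        · obtain rfl : i = 0 := by omega
          rw [splice_of_lt one_pos, reflect_apply, Fin.ext_iff, Fin.val_rev, hT0,
            letter_val (by omega)]
          omega
        · rw [hshift' 1 one_pos, shift_iterate_splice_self]; exact hz.2
        · rw [splice_of_lt one_pos, Fin.lt_def, letter_val (by omega), hT0]; omega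
      have := box_reflect (key _ (box_reflect hx) N h2 _ (box_reflect hz')
        (LexLT.le (lexLT_of_zero (by
          rw [reflect_apply, splice_of_lt one_pos, Fin.lt_def, Fin.val_rev,
            letter_val (by omega), letter_val (by omega)]
          omega))))
      rwa [← reflect_splice, reflect_reflect] at this
  · by_cases h : LexLE (letter (M / 2)) z
    · exact ⟨z, 0, by rw [splice_zero]; exact ⟨hz, h⟩⟩
    · have h := (not_lexLE.1 h).le
      refine ⟨letter (M / 2 + 1), 1, splice_letter_mem_box hz ⟨LexLT.le (lexLT_of_zero ?_),
        lexLE_of_agree (m := 1) (fun i hi => ?_) ?_⟩, LexLT.le (lexLT_of_zero ?_)⟩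
      · rw [splice_of_lt one_pos, reflect_apply, Fin.lt_def, Fin.val_rev, hT0,
          letter_val (by omega)]
        omega
      · obtain rfl : i = 0 := by omega
        rw [splice_of_lt one_pos, Fin.ext_iff, hT0, letter_val (by omega)]
      · rw [hshift 1 one_pos, shift_iterate_splice_self]; exact h
      · rw [splice_of_lt one_pos, Fin.lt_def, letter_val (by omega), letter_val (by omega)]
        omega
  · refine ⟨letter (M / 2), fun z hz => ?_⟩
    clear hn
    induction n with
    | zero => simpa using hz
    | succ n ih =>
      rw [splice_letter_succ]
      refine ⟨splice_letter_mem_box_of_lt (by omega) ih.1 (by omega) (by omega),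
        lexLE_of_agree (m := 1) (fun i hi => (splice_of_lt hi _ _).symm) ?_⟩
      rw [shift_iterate_splice_self]
      exact ih.2

/-! ### Finite type -/

theorem apply_add_mul_of_periodic {a : Seqs M} {m : ℕ} (h : shift^[m] a = a) (s i : ℕ) :
    a (m * s + i) = a i := by
  induction s with
  | zero => simp
  | succ s ih =>
    rw [← ih, show m * (s + 1) + i = m + (m * s + i) by ring, ← shift_iterate_apply m a, h]

/-- Forbid the words of length m, a period of `a`, that do not occur in the box. The index deciding
a comparison lies in one block of length m; there `a` starts afresh by periodicity, and the block of
x occurs in an element of the box. -/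
theorem isSubshiftOfFiniteType_box {a : Seqs M} (ha : a ∈ seqV M) (hper : IsPeriodic a) :
    IsSubshiftOfFiniteType (box a) := by
  obtain ⟨m, hm, hp⟩ := hper
  refine ⟨isSubshift_box ⟨a, ha⟩, {w | w.length = m ∧ ∀ x ∈ box a, ¬ IsFactor w x},
    (List.finite_length_eq _ m).subset fun w hw => hw.1, ?_⟩
  ext x
  refine ⟨fun hx w hw => hw.2 x hx, fun hx => ?_⟩
  have hblock : ∀ n, ∃ y ∈ box a, ∀ i < m, y i = x (n + i) := fun n => by
    by_contra! hcon
    refine hx (List.ofFn fun i : Fin m => x (n + i)) ⟨by simp, fun z hz hfac => ?_⟩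
      ⟨n, fun i => by simp⟩
    obtain ⟨k, hk⟩ := hfac
    obtain ⟨i, hi, hne⟩ := hcon _ (box_shift_iterate hz k)
    refine hne ?_
    rw [shift_iterate_apply]
    simpa using (hk ⟨i, by simpa using hi⟩).symm
  intro n
  constructor
  · rw [lexLE_iff]
    intro t ht
    obtain ⟨y, hy, hyx⟩ := hblock (n + m * (t / m))
    have hd : t % m < m := Nat.mod_lt _ (by omega)
    have hdiv := Nat.div_add_mod t m
    have hpr : ∀ i, reflect a (m * (t / m) + i) = reflect a i := fun i => by
      rw [reflect_apply, apply_add_mul_of_periodic hp, reflect_apply]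
    have := lexLE_iff.1 (le_box hy) (t % m) fun i hi => by
      rw [hyx i (by omega), add_assoc, ← shift_iterate_apply n x, ← ht _ (by omega), hpr]
    rwa [hyx _ hd, add_assoc, ← hpr (t % m), hdiv, ← shift_iterate_apply n x] at this
  · rw [lexLE_iff]
    intro t ht
    obtain ⟨y, hy, hyx⟩ := hblock (n + m * (t / m))
    have hd : t % m < m := Nat.mod_lt _ (by omega)
    have hdiv := Nat.div_add_mod t m
    have hpr : ∀ i, a (m * (t / m) + i) = a i := apply_add_mul_of_periodic hp _
    have := lexLE_iff.1 (box_le hy) (t % m) fun i hi => by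
      rw [hyx i (by omega), add_assoc, ← shift_iterate_apply n x, ht _ (by omega), hpr]
    rwa [hyx _ hd, add_assoc, ← hpr (t % m), hdiv, ← shift_iterate_apply n x] at this

/-! ### The generalised golden ratio for odd `M` -/

/-- A larger expansion gains at least a full unit at the first differing digit, which the tail of
`a` can at most balance, and it has further non-zero digits, so its value would exceed 1. -/
theorem isQuasiGreedyOne_of_tail_le {q : ℝ} (hq : 1 < q) {a : Seqs M} (ha : IsExpansion q 1 a)
    (hinf : {i : ℕ | a i ≠ 0}.Infinite)
    (htail : ∀ n, ∃ v ≤ 1, IsExpansion q v (shift^[n] a)) : IsQuasiGreedyOne q a := by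
  have hq0 : 0 < q := by linarith
  refine ⟨⟨ha, hinf⟩, fun b hb hbinf => ?_⟩
  by_contra hcon
  obtain ⟨n, h1, h2⟩ := lexLT_iff.1 (not_lexLE.1 hcon)
  obtain ⟨v, hv1, hv⟩ := htail (n + 1)
  have ha' := (hasSum_nat_add_iff' (n + 1)).2 ha
  have hb' := (hasSum_nat_add_iff' (n + 1)).2 hb
  have hv' : HasSum (fun i => ((a (i + (n + 1)) : ℕ) : ℝ) / q ^ (i + (n + 1) + 1))
      (v / q ^ (n + 1)) := by
    have hfun : (fun i => ((a (i + (n + 1)) : ℕ) : ℝ) / q ^ (i + (n + 1) + 1)) =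
        fun i => ((shift^[n + 1] a i : ℕ) : ℝ) / q ^ (i + 1) / q ^ (n + 1) := by
      funext i
      rw [shift_iterate_apply, div_div, ← pow_add, add_comm i (n + 1)]
      congr 2
      omega
    rw [hfun]
    exact hv.div_const (q ^ (n + 1))
  have hva := ha'.unique hv'
  rw [Finset.sum_range_succ] at hva
  obtain ⟨j, hj, hnj⟩ := hbinf.exists_gt n
  have hpos : 0 < ((b j : ℕ) : ℝ) / q ^ (j + 1) := by
    have : 0 < (b j : ℕ) := Nat.pos_of_ne_zero fun h => hj (Fin.ext h)
    positivity
  have hle := le_hasSum hb' (j - (n + 1)) fun i _ => by positivity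
  rw [Nat.sub_add_cancel (by omega), Finset.sum_range_succ,
    Finset.sum_congr rfl (fun i hi => by rw [← h1 i (Finset.mem_range.1 hi)])] at hle
  have h3 : ((a n : ℕ) : ℝ) / q ^ (n + 1) + 1 / q ^ (n + 1) ≤ ((b n : ℕ) : ℝ) / q ^ (n + 1) := by
    rw [← add_div]
    refine div_le_div_of_nonneg_right ?_ (by positivity)
    exact_mod_cast h2
  have h4 : v / q ^ (n + 1) ≤ 1 / q ^ (n + 1) := div_le_div_of_nonneg_right hv1 (by positivity)
  linarith

theorem summable_expansion {q : ℝ} (hq : 1 < q) (a : Seqs M) :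
    Summable fun i : ℕ => ((a i : ℕ) : ℝ) / q ^ (i + 1) := by
  have hq0 : 0 < q := by linarith
  have hg : Summable fun i : ℕ => (M : ℝ) * (q⁻¹) ^ (i + 1) :=
    ((summable_nat_add_iff 1).2
      (summable_geometric_of_lt_one (by positivity) (inv_lt_one_of_one_lt₀ hq))).mul_left _
  refine Summable.of_nonneg_of_le (fun i => by positivity) (fun i => ?_) hg
  rw [inv_pow, ← div_eq_mul_inv]
  refine div_le_div_of_nonneg_right ?_ (by positivity)
  exact_mod_cast Nat.lt_succ_iff.1 (a i).2

theorem IsExpansion.shift {q s : ℝ} (hq : 1 < q) {a : Seqs M} (h : IsExpansion q s a) :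
    IsExpansion q (q * s - (a 0 : ℕ)) (shift a) := by
  have hq0 : q ≠ 0 := by linarith
  have h1 := ((hasSum_nat_add_iff' 1).2 h).mul_left q
  have h2 : q * (s - ∑ i ∈ Finset.range 1, ((a i : ℕ) : ℝ) / q ^ (i + 1)) =
      q * s - (a 0 : ℕ) := by
    simp; field_simp
  rw [h2] at h1
  unfold IsExpansion
  have hfun : (fun i => ((SymShift.shift a i : ℕ) : ℝ) / q ^ (i + 1)) =
      fun i => q * (((a (i + 1) : ℕ) : ℝ) / q ^ (i + 1 + 1)) := by
    funext i
    change ((a (i + 1) : ℕ) : ℝ) / q ^ (i + 1) = _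
    rw [pow_succ q (i + 1)]
    field_simp
  rw [hfun]
  exact h1

theorem shift_shift_alternating : shift (shift (alternating M)) = alternating M :=
  shift_iterate_two_mul_alternating 1

/-- The expansion `((k + 1) k)^∞` has the value `1` in base `q` exactly if
`q² = (k + 1) (q + 1)`. -/
theorem isExpansion_alternating_iff (hM : Odd M) {q : ℝ} (hq : 1 < q) :
    IsExpansion q 1 (alternating M) ↔ q ^ 2 = ((M / 2 : ℕ) + 1) * (q + 1) := by
  have h1 : 1 ≤ M := hM.pos
  have e0 : ((alternating M 0 : ℕ) : ℝ) = (M / 2 : ℕ) + 1 := by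
    rw [alternating_val h1]; simp
  have e1 : ((SymShift.shift (alternating M) 0 : ℕ) : ℝ) = (M / 2 : ℕ) := by
    rw [SymShift.shift, alternating_val h1]; simp
  have key : ∀ s, IsExpansion q s (alternating M) →
      q * (q * s - ((M / 2 : ℕ) + 1)) - (M / 2 : ℕ) = s := fun s hs => by
    have h2 := (hs.shift hq).shift hq
    rw [shift_shift_alternating, e0, e1] at h2
    exact h2.unique hs
  constructor
  · intro h
    have := key 1 h
    linarith
  · intro h
    obtain ⟨s, hs⟩ := summable_expansion hq (alternating M)
    have h2 := key s hs
    have h3 : (q ^ 2 - 1) * (s - 1) = 0 := by linarith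
    have h4 : q ^ 2 - 1 ≠ 0 := by nlinarith
    have h5 : s = 1 := by
      rcases mul_eq_zero.1 h3 with h | h
      · exact absurd h h4
      · linarith
    rw [← h5]; exact hs

theorem qG_spec (hM : Odd M) : 1 < qG M ∧ qG M ^ 2 = ((M / 2 : ℕ) + 1) * (qG M + 1) := by
  have hq : qG M = (((M / 2 : ℕ) : ℝ) + 1
    + Real.sqrt (((M / 2 : ℕ) : ℝ) ^ 2 + 6 * ((M / 2 : ℕ) : ℝ) + 5)) / 2 :=
    if_neg (Nat.not_even_iff_odd.2 hM)
  rw [hq]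
  set k := ((M / 2 : ℕ) : ℝ) with hk
  have hk0 : 0 ≤ k := Nat.cast_nonneg _
  have h1 := Real.sq_sqrt (show 0 ≤ k ^ 2 + 6 * k + 5 by positivity)
  have h2 : k + 2 ≤ Real.sqrt (k ^ 2 + 6 * k + 5) := Real.le_sqrt_of_sq_le (by nlinarith)
  set r := Real.sqrt (k ^ 2 + 6 * k + 5)
  constructor
  · linarith
  · nlinarith

theorem eq_qG (hM : Odd M) {q : ℝ} (hq : 1 < q) (h : q ^ 2 = ((M / 2 : ℕ) + 1) * (q + 1)) :
    q = qG M := by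
  obtain ⟨h1, h2⟩ := qG_spec hM
  -- Eliminating k + 1 from the two quadratic equations leaves this factorisation.
  have h3 : (q - qG M) * (q * qG M + q + qG M) = 0 := by
    linear_combination (qG M + 1) * h - (q + 1) * h2
  rcases mul_eq_zero.1 h3 with h4 | h4
  · linarith
  · have : 0 < q * qG M + q + qG M := by positivity
    linarith

theorem alpha_qG (hM : Odd M) : alpha M (qG M) = alternating M := by
  obtain ⟨h1, h2⟩ := qG_spec hM
  have hM1 : 1 ≤ M := hM.pos
  have hexp := (isExpansion_alternating_iff hM h1).2 h2
  have hqg : IsQuasiGreedyOne (qG M) (alternating M) := by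
    refine isQuasiGreedyOne_of_tail_le h1 hexp ?_ fun n => ?_
    · refine Set.infinite_of_forall_exists_gt fun n => ⟨2 * (n + 1), ?_, by omega⟩
      intro h
      have := congrArg Fin.val h
      rw [alternating_val hM1, if_pos (by simp)] at this
      simp at this
    · rcases Nat.even_or_odd' n with ⟨s, rfl | rfl⟩
      · exact ⟨1, le_rfl, by rwa [shift_iterate_two_mul_alternating]⟩
      · refine ⟨qG M * 1 - (alternating M 0 : ℕ), ?_, ?_⟩
        · have e0 : ((alternating M 0 : ℕ) : ℝ) = (M / 2 : ℕ) + 1 := by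
            rw [alternating_val hM1]; simp
          rw [e0]
          have hk0 : (0 : ℝ) ≤ (M / 2 : ℕ) := Nat.cast_nonneg _
          nlinarith
        · rw [← shift_iterate_add 1 (2 * s), shift_iterate_two_mul_alternating]
          exact hexp.shift h1
  exact isQuasiGreedyOne_unique (Classical.epsilon_spec ⟨_, hqg⟩) hqg

theorem eq_qG_of_alpha_eq (hM : Odd M) {q : ℝ} (hq : 1 < q) (hq' : q ≤ M + 1)
    (h : alpha M q = alternating M) : q = qG M := by
  refine eq_qG hM hq ((isExpansion_alternating_iff hM hq).1 ?_)
  rw [← h]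
  exact (isQuasiGreedyOne_alpha hq hq').1.1

/-! ### Mixing of symmetric shifts -/

theorem isMixingSubshift_symShift_of_mem_baseI {q : ℝ} (hq : q ∈ baseI M)
    (hne : ¬ (Odd M ∧ q = qG M)) : IsMixingSubshift (symShift M q) := by
  obtain ⟨⟨hq1, hq2, ha⟩, hirr⟩ := hq
  change IsMixingSubshift (box (alpha M q))
  have hne' : Odd M → alpha M q ≠ alternating M := fun hO h =>
    hne ⟨hO, eq_qG_of_alpha_eq hO hq1 hq2 h⟩
  set a := alpha M q
  have ha0 := half_le_apply_zero ha
  by_cases h0 : (a 0 : ℕ) ≤ M / 2 ∧ Even M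
  · exact isMixingSubshift_box_of_const h0.2 ha h0.1
  · have hlt : M < 2 * (a 0 : ℕ) := by
      rcases Nat.even_or_odd' M with ⟨k, hk | hk⟩
      · have hE : Even M := ⟨k, by omega⟩
        have : ¬ (a 0 : ℕ) ≤ M / 2 := fun h => h0 ⟨h, hE⟩
        omega
      · omega
    have h0' : (a 0).rev < a 0 := by rw [Fin.lt_def, Fin.val_rev]; omega
    refine isMixingSubshift_box_of_irreducible hirr h0' fun hB => ?_
    have hO : Odd M := ⟨(a 0 : ℕ) - 1, by omega⟩
    have hM := hO.pos
    have h1 : ¬ (a 1 : ℕ) ≤ M / 2 := fun h => hne' hO (eq_alternating hO ha (by omega) h)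
    have h1' := box_apply_le (show a ∈ box a from ha) 1
    rw [Fin.le_def] at h1'
    have hD : NoReflectedSuffix a (1 + 1) := by
      intro i hi
      refine ⟨0, by omega, fun h => ?_⟩
      have h2 := congrArg Fin.val h
      rw [Fin.val_rev, add_zero] at h2
      rcases (show i = 0 ∨ i = 1 by omega) with rfl | rfl <;> omega
    have hc := lowered_mem_seqV ha h0' hD (Or.inl le_rfl)
    by_contra hcon
    have h2 := (isIrreducibleSeq_iff.1 hirr).2 1 (hD.pos ha) hc
    have := splice_lowered_one_eq hO (a := a) (by omega) (by omega)
    exact hcon (this ▸ h2)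

theorem isMixingSubshift_box_of_transitive (hM : 1 ≤ M) {a : Seqs M} (ha : a ∈ seqV M)
    (hT : LexLT (transitiveSeq M) a) (htr : IsTransitiveSubshift (box a)) :
    IsMixingSubshift (box a) := by
  have ha0 := le_of_transitiveSeq_lt hM hT
  refine isMixingSubshift_box_of_irreducible (isIrreducibleSeq_of_transitive hM ha hT htr) ?_
    fun _ => hT
  rw [Fin.lt_def, Fin.val_rev]; omega

/-- If T ≺ a, the box of `a` contains a prefix (k+1)((k+1)k)^s followed by T, which is larger than T
and so outside the box of T. This recovers α(q) from the largest element of its box. -/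
theorem eq_transitiveSeq_of_box_eq (hO : Odd M) {a : Seqs M} (ha : transitiveSeq M ∈ box a)
    (h : box a = box (transitiveSeq M)) : a = transitiveSeq M := by
  have hM := hO.pos
  by_contra hne
  have hlt : LexLT (transitiveSeq M) a :=
    lt_of_le_of_ne (box_le ha) fun he => hne (toLex.injective he).symm
  obtain ⟨s, hs⟩ := exists_splice_transitiveSeq_mem_box hO hlt
  have hmem := hs s le_rfl _ ha (transitiveSeq_zero hM).ge
  rw [h] at hmem
  refine absurd (box_le hmem) (not_lexLE.2 (lexLT_iff.2 ⟨2 * s + 1 + 1, fun i hi => ?_, ?_⟩))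
  · by_cases hi' : i < 2 * s + 1
    · rw [splice_of_lt hi']
    · obtain rfl : i = 2 * s + 1 := by omega
      apply Fin.ext
      rw [splice_of_le le_rfl, Nat.sub_self, transitiveSeq_zero hM, transitiveSeq_succ_of_odd hO,
        alternating_val hM, if_pos (by simp)]
  · rw [splice_add, Fin.lt_def, transitiveSeq_one_of_odd hO, transitiveSeq_succ_of_odd hO,
      alternating_val hM, if_neg (by simp)]
    omega

theorem isMixingSubshift_symShift_of_transitive (hM : 1 ≤ M) {q : ℝ} (hq : qG M ≤ q)
    (hq' : q ≤ M + 1) (htr : IsTransitiveSubshift (symShift M q))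
    (hne : ¬ (Odd M ∧ (IsTransitiveBase M q ∨ symShift M q = symShift M (qG M)))) :
    IsMixingSubshift (symShift M q) := by
  change IsTransitiveSubshift (box (alpha M q)) at htr
  change IsMixingSubshift (box (alpha M q))
  -- From here on b, which lies in V, takes the place of α(q), which need not.
  obtain ⟨b, hb, hba, heq⟩ := exists_box_eq htr.1.1
  rw [heq] at htr ⊢
  have hb0 := half_le_apply_zero hb
  rcases Nat.even_or_odd M with hE | hO
  · by_cases h0 : (b 0 : ℕ) ≤ M / 2
    · exact isMixingSubshift_box_of_const hE hb h0
    · rcases lexLT_trichotomy b (transitiveSeq M) with hT | rfl | hT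
      · have h1 := hT.le.apply_zero
        rw [Fin.le_def, transitiveSeq_zero hM] at h1
        exact absurd htr (not_transitive_of_even hM hE hb (by omega) hT)
      · exact isMixingSubshift_box_transitiveSeq hM hE hb
      · exact isMixingSubshift_box_of_transitive hM hb hT htr
  · have hMk : M = 2 * (M / 2) + 1 := (Nat.two_mul_div_two_add_one_of_odd hO).symm
    rcases lexLT_trichotomy b (transitiveSeq M) with hT | rfl | hT
    · have h1 := hT.le.apply_zero
      rw [Fin.le_def, transitiveSeq_zero hM] at h1
      have h2 := box_apply_le (show b ∈ box b from hb) 1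
      rw [Fin.le_def] at h2
      by_cases h3 : (b 1 : ℕ) ≤ M / 2
      · have hbalt := eq_alternating hO hb (by omega) h3
        refine absurd ⟨hO, Or.inr ?_⟩ hne
        change box (alpha M q) = box (alpha M (qG M))
        rw [heq, hbalt, alpha_qG hO]
      · exact absurd htr (not_transitive_of_odd hO hb (by omega) (by omega) hT)
    · refine absurd ⟨hO, Or.inl ⟨?_, hq', eq_transitiveSeq_of_box_eq hO hba heq⟩⟩ hne
      exact (qG_spec hO).1.trans_le hq
    · exact isMixingSubshift_box_of_transitive hM hb hT htr

end SymShift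

theorem mainTheorem3 (M : ℕ) (hM : 1 ≤ M) :
    (∀ q ∈ SymShift.baseI M, ¬ (Odd M ∧ q = SymShift.qG M) →
      SymShift.IsMixingSubshift (SymShift.symShift M q)) ∧
    (∀ q ∈ SymShift.baseI M, SymShift.IsPeriodic (SymShift.alpha M q) →
      SymShift.IsSubshiftOfFiniteType (SymShift.symShift M q) ∧
        (¬ (Odd M ∧ q = SymShift.qG M) →
          SymShift.IsMixingSubshift (SymShift.symShift M q))) ∧
    (∀ q : ℝ, SymShift.qG M ≤ q → q ≤ M + 1 →
      SymShift.IsTransitiveSubshift (SymShift.symShift M q) →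
      ¬ (Odd M ∧ (SymShift.IsTransitiveBase M q ∨
        SymShift.symShift M q = SymShift.symShift M (SymShift.qG M))) →
      SymShift.IsMixingSubshift (SymShift.symShift M q)) :=
  ⟨fun _ hq hne => SymShift.isMixingSubshift_symShift_of_mem_baseI hq hne,
    fun _ hq hper => ⟨SymShift.isSubshiftOfFiniteType_box hq.1.2.2 hper,
      fun hne => SymShift.isMixingSubshift_symShift_of_mem_baseI hq hne⟩,
    fun _ hq hq' htr hne =>
      SymShift.isMixingSubshift_symShift_of_transitive hM hq hq' htr hne⟩
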